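/- For a real symmetric positive-definite $N\times N$ matrix $S$ put $\Lambda_S := \{\,{}^t v S v : 0\neq v\in\mathbb{Z}^N\,\}\subset\mathbb{R}_{>0}$, and call $S, S'$ equivalent if $S' = g S\,{}^t g$ for some $g\in GL_N(\mathbb{Z})$. (1) Let $S$ and $S_2$ be real symmetric positive-definite matrices of sizes $N$ and $N_2$ with $0<N_2<N\le 4$. Then $\Lambda_{S_2}\not\supset\Lambda_S$. (2) For $N\le 4$ and every set $\Lambda\subset\mathbb{R}$, there are only finitely many equivalence classes of real symmetric positive-definite $N\times N$ matrices $S$ with $\Lambda_S=\Lambda$. (3) Let $1\le N\le 4$, let $S_0$ be a real symmetric positive-definite $N\times N$ matrix, let $0<c\le\infty$ be such that $\Lambda_{S_0}\cap(0,c)\ne\emptyset$, and list the elements of $\Lambda_{S_0}\cap(0,c)$ in increasing order as $q_1<q_2<\dots$, with $M\le\infty$ terms. Consider the recursive procedure $P(m,n,S,I,J)$, in which $S=(s_{ij})$ is an $N\times N$ array passed by value: for $l=I,\dots,J$ do the following. - If $m=n$, set $s_{nn}=q_l$; otherwise set $s_{mn}=s_{nm}=\tfrac12(q_l-s_{mm}-s_{nn})$.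 - If $m=1$ and $\det(s_{ij})_{1\le i,j\le n}\le 0$, do nothing more in this pass. - If $m=1$, $\det(s_{ij})_{1\le i,j\le n}>0$ and $n=N$, insert $S$ in the output list. - If $m=1$, $\det(s_{ij})_{1\le i,j\le n}>0$ and $n<N$, let $m_2$ be the largest index $i$ with $1\le i\le M$ such that $q_1,\dots,q_{i-1}\in\Lambda_{(s_{ij})_{1\le i,j\le n}}$, and call $P(n+1,n+1,S,l,m_2)$ if $n=1$, and $P(n+1,n+1,S,I,m_2)$ if $n>1$. - If $m>1$ and $m=n$, let $m_2$ be the largest index $i$ with $q_i\le s_{n-1,n-1}+s_{nn}$, and call $P(m-1,n,S,l,m_2)$. - If $m>1$ and $m\neq n$, let $m_2$ be the largest index $i$ with $q_i\le 2s_{m-1,m-1}+s_{nn}$, and call $P(m-1,n,S,I,m_2)$. Then the call $P(1,1,S,1,1)$, with arbitrary initial $S$, is completed in finitely many steps (in particular, every maximum $m_2$ that it needs exists), even if $c=\infty$, and every matrix in its output list is positive definite. Moreover, there is a $c_0$, depending on $S_0$, such that for all $c$ with $c_0\le c\le\infty$ the output list contains a representative of every equivalence class of real symmetric positive-definite $N\times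 N$ matrices $S$ with $\Lambda_S=\Lambda_{S_0}$. -/

import Mathlib

open scoped Matrix

namespace LatticeEnum

/-- `Λ_S = { ᵗv S v : 0 ≠ v ∈ ℤ^N }`, the set of representations of `S` over `ℤ`. -/
def Rep {N : ℕ} (S : Matrix (Fin N) (Fin N) ℝ) : Set ℝ :=
  {x | ∃ v : Fin N → ℤ, v ≠ 0 ∧ x = (fun i => (v i : ℝ)) ⬝ᵥ (S *ᵥ fun i => (v i : ℝ))}

/-- `S₁` and `S₂` are equivalent: `S₂ = g S₁ ᵗg` for some `g ∈ GL_N(ℤ)`. -/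
def Equivalent {N : ℕ} (S₁ S₂ : Matrix (Fin N) (Fin N) ℝ) : Prop :=
  ∃ g : GL (Fin N) ℤ,
    S₂ = (g : Matrix (Fin N) (Fin N) ℤ).map (Int.cast : ℤ → ℝ) * S₁ *
      ((g : Matrix (Fin N) (Fin N) ℤ).map (Int.cast : ℤ → ℝ))ᵀ

theorem Equivalent.refl {N : ℕ} (S : Matrix (Fin N) (Fin N) ℝ) : Equivalent S S :=
  ⟨1, by simp [Matrix.map_one]⟩

theorem Equivalent.symm {N : ℕ} {S₁ S₂ : Matrix (Fin N) (Fin N) ℝ}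
    (h : Equivalent S₁ S₂) : Equivalent S₂ S₁ := by
  obtain ⟨g, rfl⟩ := h
  refine ⟨g⁻¹, ?_⟩
  have h1 : ((g⁻¹ : GL (Fin N) ℤ) : Matrix (Fin N) (Fin N) ℤ).map (Int.cast : ℤ → ℝ) *
      (g : Matrix (Fin N) (Fin N) ℤ).map (Int.cast : ℤ → ℝ) = 1 := by
    have h2 := congrArg (fun A : Matrix (Fin N) (Fin N) ℤ => A.map (Int.castRingHom ℝ))
      (Units.inv_mul g)
    simp only [Matrix.map_mul] at h2
    simpa [Matrix.map_one] using h2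
  generalize ((g⁻¹ : GL (Fin N) ℤ) : Matrix (Fin N) (Fin N) ℤ).map (Int.cast : ℤ → ℝ) = B at *
  generalize (g : Matrix (Fin N) (Fin N) ℤ).map (Int.cast : ℤ → ℝ) = A at *
  have h3 : Aᵀ * Bᵀ = 1 := by rw [← Matrix.transpose_mul, h1, Matrix.transpose_one]
  calc S₁ = (B * A) * S₁ * (Aᵀ * Bᵀ) := by rw [h1, h3]; simp
    _ = B * (A * S₁ * Aᵀ) * Bᵀ := by simp only [Matrix.mul_assoc]

theorem Equivalent.trans {N : ℕ} {S₁ S₂ S₃ : Matrix (Fin N) (Fin N) ℝ}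
    (h : Equivalent S₁ S₂) (h' : Equivalent S₂ S₃) : Equivalent S₁ S₃ := by
  obtain ⟨g, rfl⟩ := h
  obtain ⟨g', rfl⟩ := h'
  refine ⟨g' * g, ?_⟩
  have h1 : ((g' * g : GL (Fin N) ℤ) : Matrix (Fin N) (Fin N) ℤ).map (Int.cast : ℤ → ℝ) =
      (g' : Matrix (Fin N) (Fin N) ℤ).map (Int.cast : ℤ → ℝ) *
      (g : Matrix (Fin N) (Fin N) ℤ).map (Int.cast : ℤ → ℝ) :=
    Matrix.map_mul (f := Int.castRingHom ℝ)
  rw [h1, Matrix.transpose_mul]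
  simp only [Matrix.mul_assoc]

/-- Equivalence of `N × N` matrices under `GL_N(ℤ)`; its quotient is the set of classes. -/
def equivSetoid (N : ℕ) : Setoid (Matrix (Fin N) (Fin N) ℝ) where
  r := Equivalent
  iseqv := ⟨Equivalent.refl, Equivalent.symm, Equivalent.trans⟩

/-- The elements of `Rep S` in the interval `(0, c)`, where `0 < c ≤ ∞`. -/
def Observed {N : ℕ} (S : Matrix (Fin N) (Fin N) ℝ) (c : EReal) : Set ℝ :=
  {x | x ∈ Rep S ∧ 0 < x ∧ (x : EReal) < c}

/-- `⟨q 1, …, q M⟩` (or `⟨q 1, q 2, …⟩` if `M = ⊤`) is the sorted sequence, without repetition,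
of all the elements of `A`. -/
def IsSortedListing (A : Set ℝ) (M : ℕ∞) (q : ℕ → ℝ) : Prop :=
  StrictMonoOn q {i | 1 ≤ i ∧ (i : ℕ∞) ≤ M} ∧ q '' {i | 1 ≤ i ∧ (i : ℕ∞) ≤ M} = A

/-- The submatrix `(s_{ij})_{1 ≤ i, j ≤ n}` of an array whose indices start at `1`. -/
def lead (S : ℕ → ℕ → ℝ) (n : ℕ) : Matrix (Fin n) (Fin n) ℝ :=
  Matrix.of fun i j => S (i + 1) (j + 1)

/-- The assignment `s_{mn} = s_{nm} = x`. -/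
def assign (S : ℕ → ℕ → ℝ) (m n : ℕ) (x : ℝ) : ℕ → ℕ → ℝ :=
  fun i j => if (i = m ∧ j = n) ∨ (i = n ∧ j = m) then x else S i j

/-- The value given to `s_{mn}` in the pass of the loop with counter `l`: it is `q_l` if `m = n`,
and otherwise it makes `s_{mm} + s_{nn} + 2 s_{mn}` equal to `q_l`. -/
noncomputable def newEntry (q : ℕ → ℝ) (S : ℕ → ℕ → ℝ) (m n l : ℕ) : ℝ :=
  if m = n then q l else (1 / 2) * (q l - S m m - S n n)

/-- The program points of the recursive procedure: `loop m n S I l J` is about to execute the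
passes `l, l + 1, …, J` of the loop `for l = I to J` in a call with arguments `m, n, S, I, J`;
`body m n S I l` has just assigned `s_{mn}` in the pass with counter `l`. -/
inductive Config where
  | loop (m n : ℕ) (S : ℕ → ℕ → ℝ) (I l J : ℕ) : Config
  | body (m n : ℕ) (S : ℕ → ℕ → ℝ) (I l : ℕ) : Config

/-- The call of the recursive procedure with arguments `m, n, S, I, J`. -/
def call (m n : ℕ) (S : ℕ → ℕ → ℝ) (I J : ℕ) : Config := Config.loop m n S I I J

/-- Execution of the recursive procedure for rank `N` on the sorted sequence `q` of length `M`: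
`Exec N M q C k Ans` says that, from the program point `C`, execution is completed after `k`
steps, and that `Ans` is the list of matrices inserted meanwhile.  The maxima that serve as upper
ends of the loops have to exist: if one does not, execution is not completed.  Finding a maximum
`m₂` by examining `i = 1, 2, …` is counted as `m₂ + 1` steps. -/
inductive Exec (N : ℕ) (M : ℕ∞) (q : ℕ → ℝ) :
    Config → ℕ → List (Matrix (Fin N) (Fin N) ℝ) → Prop where
  | loop_end (m n : ℕ) (S : ℕ → ℕ → ℝ) (I l J : ℕ) (h : J < l) :
      Exec N M q (Config.loop m n S I l J) 1 []
  | loop_pass (m n : ℕ) (S : ℕ → ℕ → ℝ) (I l J k₁ k₂ : ℕ)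
      (Ans₁ Ans₂ : List (Matrix (Fin N) (Fin N) ℝ)) (h : l ≤ J)
      (hbody : Exec N M q (Config.body m n (assign S m n (newEntry q S m n l)) I l) k₁ Ans₁)
      (hrest : Exec N M q (Config.loop m n S I (l + 1) J) k₂ Ans₂) :
      Exec N M q (Config.loop m n S I l J) (k₁ + k₂ + 1) (Ans₁ ++ Ans₂)
  | reject (m n : ℕ) (S : ℕ → ℕ → ℝ) (I l : ℕ) (hm : m = 1) (hdet : ¬ 0 < (lead S n).det) :
      Exec N M q (Config.body m n S I l) 1 []
  | insert (m n : ℕ) (S : ℕ → ℕ → ℝ) (I l : ℕ) (hm : m = 1) (hdet : 0 < (lead S n).det)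
      (hn : N ≤ n) :
      Exec N M q (Config.body m n S I l) 1 [lead S N]
  | next_rank (m n : ℕ) (S : ℕ → ℕ → ℝ) (I l m₂ k : ℕ)
      (Ans : List (Matrix (Fin N) (Fin N) ℝ)) (hm : m = 1) (hdet : 0 < (lead S n).det)
      (hn : n < N)
      (hmax : IsGreatest {i : ℕ | 1 ≤ i ∧ (i : ℕ∞) ≤ M ∧
        ∀ j : ℕ, 1 ≤ j → j < i → q j ∈ Rep (lead S n)} m₂)
      (hcall : Exec N M q (call (n + 1) (n + 1) S (if m = n then l else I) m₂) k Ans) :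
      Exec N M q (Config.body m n S I l) (m₂ + 1 + k) Ans
  | next_row_diag (m n : ℕ) (S : ℕ → ℕ → ℝ) (I l m₂ k : ℕ)
      (Ans : List (Matrix (Fin N) (Fin N) ℝ)) (hm : m ≠ 1) (hmn : m = n)
      (hmax : IsGreatest {i : ℕ | 1 ≤ i ∧ (i : ℕ∞) ≤ M ∧
        q i ≤ S (n - 1) (n - 1) + S n n} m₂)
      (hcall : Exec N M q (call (m - 1) n S l m₂) k Ans) :
      Exec N M q (Config.body m n S I l) (m₂ + 1 + k) Ans
  | next_row (m n : ℕ) (S : ℕ → ℕ → ℝ) (I l m₂ k : ℕ)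
      (Ans : List (Matrix (Fin N) (Fin N) ℝ)) (hm : m ≠ 1) (hmn : m ≠ n)
      (hmax : IsGreatest {i : ℕ | 1 ≤ i ∧ (i : ℕ∞) ≤ M ∧
        q i ≤ 2 * S (m - 1) (m - 1) + S n n} m₂)
      (hcall : Exec N M q (call (m - 1) n S I m₂) k Ans) :
      Exec N M q (Config.body m n S I l) (m₂ + 1 + k) Ans

end LatticeEnum

namespace LatticeEnum

/-! Rank comparison. The crux is that a positive definite quaternary form represents a number that a
given positive definite ternary form misses. Over `ℚ` the reason is local. A definite ternary form
is anisotropic over some `ℚ_p`, since isotropy at every prime would give a rational zero by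
Legendre's theorem. At such a p it misses the square class of minus its determinant, whereas a
quaternary form takes every nonzero value over `ℚ_p` because quinary forms are isotropic there.
Square classes are open and `ℚ` is dense in `ℚ_p`, so a rational vector exhibits the missed value
(`exists_value_not_ternary`). Real forms are handled by a `ℚ`-linear map `ℝ → ℚ` that moves the
finitely many entries very little: it keeps both forms positive definite and preserves every
coincidence of values at integral vectors. Smaller ranks are padded with unit blocks up to 4 and 3
(`not_rep_subset`).

Finiteness. In rank at most 4 vectors realising the successive minima can be chosen to form a basis,
so every class contains a `Reduced` matrix. There, any value below a diagonal entry comes from the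
preceding leading block. That block has smaller rank and hence misses some element of Λ, which
bounds the diagonal entry. By polarization the entries of a block with bounded diagonal lie in a
finite set determined by Λ, so only finitely many blocks occur and the bound is uniform
(`exists_diag_bound`).

Procedure. Its upper ends exist because Λ has finitely many elements below any bound and because no
block of smaller rank represents all of Λ. Its loop ranges encode inequalities valid for reduced
matrices (collected in `Target`), so a reduced matrix is found as soon as c exceeds its values at
the vectors e_i and e_i + e_j. Positive definiteness passes from one leading block to the next by
the sign of the determinant. `callCompletes` is the induction over nested calls. -/

/-! ### Squares in `ℚ_p` by Hensel's lemma -/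

/-- An element of `ℤ_p` close to `1` is a square. -/
theorem isSquare_of_norm_sub_one_lt {p : ℕ} [Fact p.Prime] (u : ℤ_[p])
    (hu : ‖u - 1‖ < ‖(2 : ℤ_[p])‖ ^ 2) : IsSquare u := by
  have h := hensels_lemma (R := ℤ_[p]) (p := p)
    (F := (Polynomial.X ^ 2 - Polynomial.C u)) (a := (1 : ℤ_[p]))
    (by simpa [norm_sub_rev, one_add_one_eq_two] using hu)
  obtain ⟨z, hz, -⟩ := h
  refine ⟨z, ?_⟩
  have : z ^ 2 - u = 0 := by simpa using hz
  linear_combination -this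

theorem padic_isSquare_of_norm_sub_one_lt {p : ℕ} [Fact p.Prime] (u : ℚ_[p])
    (hu : ‖u - 1‖ < ‖(2 : ℚ_[p])‖ ^ 2) : IsSquare u := by
  have h2 : ‖(2 : ℚ_[p])‖ ≤ 1 := by
    simpa using Padic.norm_int_le_one (p := p) 2
  have h1 : ‖u - 1‖ ≤ 1 := hu.le.trans (pow_le_one₀ (norm_nonneg _) h2)
  have hle : ‖u‖ ≤ 1 := by
    have := Padic.nonarchimedean (u - 1) 1
    simp only [sub_add_cancel, norm_one] at this
    exact this.trans (max_le h1 le_rfl)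
  obtain ⟨z, hz⟩ := isSquare_of_norm_sub_one_lt (⟨u, hle⟩ : ℤ_[p]) (by
    have : ((2 : ℤ_[p]) : ℚ_[p]) = 2 := by norm_cast
    rw [PadicInt.norm_def, PadicInt.norm_def, this]; exact hu)
  exact ⟨z, by simpa using congrArg (fun x : ℤ_[p] => (x : ℚ_[p])) hz⟩

/-- The quotient -w/a is so close to 1 that it is a square. This lifts a congruence a + w ≡ 0 to an
exact zero by correcting the one coordinate with unit coefficient. -/
theorem exists_sq_of_norm_add_lt {p : ℕ} [Fact p.Prime] (a w : ℤ_[p]) (ha : ‖a‖ = 1)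
    (hw : ‖a + w‖ < ‖(2 : ℤ_[p])‖ ^ 2) : ∃ t : ℚ_[p], t ≠ 0 ∧ (a : ℚ_[p]) * t ^ 2 + w = 0 := by
  have ha0 : (a : ℚ_[p]) ≠ 0 := by
    intro h
    rw [PadicInt.norm_def, h] at ha
    simp at ha
  have h2 : ((2 : ℤ_[p]) : ℚ_[p]) = 2 := by norm_cast
  have hn : ‖-(w : ℚ_[p]) / a - 1‖ < ‖(2 : ℚ_[p])‖ ^ 2 := by
    have : -(w : ℚ_[p]) / a - 1 = -((a + w : ℤ_[p]) : ℚ_[p]) / a := by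
      push_cast; field_simp; ring
    rw [this, norm_div, norm_neg, ← PadicInt.norm_def, ← PadicInt.norm_def, ha, div_one, ← h2,
      ← PadicInt.norm_def]
    exact hw
  obtain ⟨t, ht⟩ := padic_isSquare_of_norm_sub_one_lt _ hn
  refine ⟨t, ?_, ?_⟩
  · rintro rfl
    rw [ht] at hn
    have h2 : ‖(2 : ℚ_[p])‖ ≤ 1 := by simpa using Padic.norm_int_le_one (p := p) 2
    have := pow_le_one₀ (n := 2) (norm_nonneg _) h2
    simp at hn
    linarith
  · have : (t ^ 2 : ℚ_[p]) = -w / a := by rw [ht]; ring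
    rw [this]; field_simp; ring

/-! ### Isotropic diagonal forms and the local theory in rank five and four -/

/-- The diagonal form with coefficients `a` has a nontrivial zero. -/
def Isotropic {K : Type*} [Field K] {ι : Type*} [Fintype ι] (a : ι → K) : Prop :=
  ∃ x : ι → K, x ≠ 0 ∧ ∑ i, a i * x i ^ 2 = 0

section Isotropic
variable {K : Type*} [Field K] {ι : Type*} [Fintype ι]

theorem Isotropic.perm {a : ι → K} (σ : Equiv.Perm ι) (h : Isotropic (a ∘ σ)) : Isotropic a := by
  obtain ⟨x, hx, hs⟩ := h
  refine ⟨x ∘ σ.symm, ?_, ?_⟩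
  · intro h0
    apply hx
    funext i
    simpa using congrFun h0 (σ i)
  · rw [← hs, ← Equiv.sum_comp σ]
    simp

theorem Isotropic.of_mul_sq {a b : ι → K} (s : ι → K) (hs : ∀ i, s i ≠ 0)
    (hab : ∀ i, a i = b i * s i ^ 2) (h : Isotropic b) : Isotropic a := by
  obtain ⟨x, hx, h0⟩ := h
  refine ⟨fun i => x i / s i, ?_, ?_⟩
  · intro h1
    apply hx
    funext i
    have := congrFun h1 i
    simpa [hs i] using this
  · rw [← h0]
    refine Finset.sum_congr rfl fun i _ => ?_
    rw [hab]
    have := hs i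
    field_simp

theorem Isotropic.of_mul {a b : ι → K} (c : K) (hc : c ≠ 0)
    (hab : ∀ i, b i = c * a i) (h : Isotropic b) : Isotropic a := by
  obtain ⟨x, hx, h0⟩ := h
  refine ⟨x, hx, ?_⟩
  have : c * ∑ i, a i * x i ^ 2 = 0 := by
    rw [← h0, Finset.mul_sum]
    exact Finset.sum_congr rfl fun i _ => by rw [hab]; ring
  exact (mul_eq_zero.1 this).resolve_left hc

/-- For an isotropic vector v with v_i ≠ 0 the form is affine in s along s v + e_i, with slope 2 a_i
v_i ≠ 0, so it takes every value there. -/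
theorem Isotropic.universal [DecidableEq ι] (h2 : (2 : K) ≠ 0) {a : ι → K} (ha : ∀ i, a i ≠ 0)
    (h : Isotropic a) (t : K) : ∃ x : ι → K, ∑ i, a i * x i ^ 2 = t := by
  obtain ⟨v, hv, h0⟩ := h
  obtain ⟨i, hi⟩ := Function.ne_iff.1 hv
  have hi : v i ≠ 0 := hi
  have hai := ha i
  refine ⟨fun j => (t - a i) / (2 * a i * v i) * v j + if j = i then 1 else 0, ?_⟩
  set s := (t - a i) / (2 * a i * v i) with hs
  have : ∀ j, a j * (s * v j + if j = i then 1 else 0) ^ 2 =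
      s ^ 2 * (a j * v j ^ 2) + if j = i then 2 * s * a i * v i + a i else 0 := by
    intro j
    split_ifs with hj
    · subst hj; ring
    · ring
  simp only [this, Finset.sum_add_distrib, ← Finset.mul_sum, h0]
  simp only [mul_zero, Finset.sum_ite_eq', Finset.mem_univ, if_true, zero_add]
  rw [hs]
  field_simp
  ring

end Isotropic

/-- Modulo squares, every element of `ℚ_p` is a unit or `p` times a unit. -/
theorem exists_unit_mul_sq {p : ℕ} [hp : Fact p.Prime] (a : ℚ_[p]) (ha : a ≠ 0) :
    ∃ (u : ℤ_[p]) (e : Bool) (s : ℚ_[p]), ‖u‖ = 1 ∧ s ≠ 0 ∧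
      a = ((if e then (p : ℚ_[p]) else 1) * u) * s ^ 2 := by
  have hp0 : (p : ℚ_[p]) ≠ 0 := by exact_mod_cast hp.out.ne_zero
  set n := a.valuation with hn
  have hu : ‖a * (p : ℚ_[p]) ^ (-n)‖ = 1 := by
    have hpr : (p : ℝ) ≠ 0 := by exact_mod_cast hp.out.ne_zero
    rw [norm_mul, Padic.norm_p_zpow, Padic.norm_eq_zpow_neg_valuation ha, ← zpow_add₀ hpr]
    simp [hn]
  rcases Int.even_or_odd' n with ⟨k, hk | hk⟩
  · refine ⟨⟨_, hu.le⟩, false, (p : ℚ_[p]) ^ k, hu, zpow_ne_zero _ hp0, ?_⟩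
    simp only [Bool.false_eq_true, if_false, one_mul]
    rw [mul_assoc, ← zpow_natCast, ← zpow_mul, ← zpow_add₀ hp0, hk]
    ring_nf; simp
  · refine ⟨⟨_, hu.le⟩, true, (p : ℚ_[p]) ^ k, hu, zpow_ne_zero _ hp0, ?_⟩
    simp only [if_true]
    rw [show (p : ℚ_[p]) * (a * (p : ℚ_[p]) ^ (-n)) * ((p : ℚ_[p]) ^ k) ^ 2 =
      a * ((p : ℚ_[p]) ^ (1:ℤ) * (p : ℚ_[p]) ^ (-n) * (p : ℚ_[p]) ^ (k * 2)) by
        rw [zpow_one, zpow_mul, zpow_ofNat]; ring, ← zpow_add₀ hp0, ← zpow_add₀ hp0, hk]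
    ring_nf; simp

/-- Pigeonhole for the parities of five valuations. -/
theorem exists_perm_three_equal (e : Fin 5 → Bool) :
    ∃ σ : Equiv.Perm (Fin 5), e (σ 1) = e (σ 0) ∧ e (σ 2) = e (σ 0) := by
  revert e
  decide

/-- Over the field with p elements, p odd, two nondegenerate squares already sum to any value, in
particular to -c. Hensel then adjusts the third coordinate, starting from 1. -/
theorem ternary_units_isotropic {p : ℕ} [hp : Fact p.Prime] (hp2 : p ≠ 2) (a b c : ℤ_[p])
    (ha : ‖a‖ = 1) (hb : ‖b‖ = 1) (hc : ‖c‖ = 1) :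
    ∃ x y t : ℚ_[p], t ≠ 0 ∧ (a : ℚ_[p]) * x ^ 2 + b * y ^ 2 + c * t ^ 2 = 0 := by
  have hunit : ∀ z : ℤ_[p], ‖z‖ = 1 → PadicInt.toZMod z ≠ 0 := by
    intro z hz h0
    rw [← RingHom.mem_ker, PadicInt.ker_toZMod, PadicInt.maximalIdeal_eq_span_p,
      Ideal.mem_span_singleton, ← PadicInt.norm_lt_one_iff_dvd] at h0
    linarith
  have hfa := hunit a ha
  have hfb := hunit b hb
  set A : ZMod p := PadicInt.toZMod a with hA
  set B : ZMod p := PadicInt.toZMod b with hB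
  set C : ZMod p := PadicInt.toZMod c with hC
  obtain ⟨x, y, hxy⟩ := FiniteField.exists_root_sum_quadratic (R := ZMod p)
    (f := Polynomial.C A * Polynomial.X ^ 2 + Polynomial.C 0 * Polynomial.X + Polynomial.C C)
    (g := Polynomial.C B * Polynomial.X ^ 2 + Polynomial.C 0 * Polynomial.X + Polynomial.C 0)
    (Polynomial.degree_quadratic hfa) (Polynomial.degree_quadratic hfb)
    (by rw [ZMod.card]; exact Nat.odd_iff.1 (hp.out.odd_of_ne_two hp2))
  simp only [map_zero, zero_mul, add_zero, Polynomial.eval_add, Polynomial.eval_mul,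
    Polynomial.eval_C, Polynomial.eval_pow, Polynomial.eval_X] at hxy
  obtain ⟨X, rfl⟩ := ZMod.ringHom_surjective (PadicInt.toZMod (p := p)) x
  obtain ⟨Y, rfl⟩ := ZMod.ringHom_surjective (PadicInt.toZMod (p := p)) y
  have h2 : ‖(2 : ℤ_[p])‖ = 1 := by
    have : ‖((2 : ℤ) : ℤ_[p])‖ = 1 := by
      rw [PadicInt.norm_intCast_eq_one_iff]
      have : Nat.Coprime 2 p := (Nat.coprime_primes Nat.prime_two hp.out).2 (Ne.symm hp2)
      exact_mod_cast this
    exact_mod_cast this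
  obtain ⟨t, ht, h⟩ := exists_sq_of_norm_add_lt c (a * X ^ 2 + b * Y ^ 2) hc (by
    rw [h2, one_pow, PadicInt.norm_lt_one_iff_dvd, ← Ideal.mem_span_singleton,
      ← PadicInt.maximalIdeal_eq_span_p, ← PadicInt.ker_toZMod, RingHom.mem_ker]
    simp only [map_add, map_mul, map_pow]
    linear_combination hxy)
  refine ⟨X, Y, t, ht, ?_⟩
  push_cast at h
  linear_combination h

/-- A congruence modulo 8 suffices at p = 2, since 1/8 < ‖2‖² = 1/4. The condition that the square
be 1 modulo 8 characterises units. -/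
theorem two_adic_exists_sq (a w : ℤ_[2]) (ha : PadicInt.toZModPow 3 a ^ 2 = 1)
    (hw : PadicInt.toZModPow 3 (a + w) = 0) :
    ∃ t : ℚ_[2], t ≠ 0 ∧ (a : ℚ_[2]) * t ^ 2 + w = 0 := by
  have h2 : ‖(2 : ℤ_[2])‖ = 2⁻¹ := by simpa using PadicInt.norm_p (p := 2)
  refine exists_sq_of_norm_add_lt a w ?_ ?_
  · by_contra hne
    have hlt : ‖a‖ < 1 := lt_of_le_of_ne (PadicInt.norm_le_one _) hne
    rw [PadicInt.norm_lt_one_iff_dvd] at hlt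
    obtain ⟨b, rfl⟩ := hlt
    rw [map_mul] at ha
    generalize PadicInt.toZModPow 3 b = z at ha
    simp only [Nat.cast_ofNat, map_ofNat] at ha
    revert z
    decide
  · rw [← RingHom.mem_ker, PadicInt.ker_toZModPow, ← PadicInt.norm_le_pow_iff_mem_span_pow] at hw
    refine hw.trans_lt ?_
    rw [h2]; norm_num

theorem toZModPow_three_sq (a : ℤ_[2]) (ha : ‖a‖ = 1) : PadicInt.toZModPow 3 a ^ 2 = 1 := by
  have : ¬ ‖a‖ < 1 := by linarith
  rw [PadicInt.norm_lt_one_iff_dvd, ← Ideal.mem_span_singleton, ← pow_one ((2 : ℕ) : ℤ_[2]),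
    ← PadicInt.ker_toZModPow, RingHom.mem_ker, ← PadicInt.zmod_cast_comp_toZModPow 1 3 (by norm_num),
    RingHom.comp_apply] at this
  generalize PadicInt.toZModPow 3 a = z at this ⊢
  revert z
  decide

/-- Four times a unit is 4 modulo 8, so two units whose sum is 0 modulo 4 give a zero, if necessary
with the help of a third coordinate equal to 2. If no pair does, all three units agree modulo 4. The
next three lemmas treat that case by the same correction by 4. -/
theorem zmod8_pairs (a b c : ZMod (2 ^ 3)) (ha : a ^ 2 = 1) (hb : b ^ 2 = 1) (hc : c ^ 2 = 1) :
    (a + (b + 4 * c) = 0 ∨ a + b = 0) ∨ (a + (c + 4 * b) = 0 ∨ a + c = 0) ∨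
      (b + (c + 4 * a) = 0 ∨ b + c = 0) ∨ ((b = a ∨ b = a + 4) ∧ (c = a ∨ c = a + 4)) := by
  revert a b c
  decide

theorem zmod8_even (a b c e : ZMod (2 ^ 3)) (ha : a ^ 2 = 1) (hc : c ^ 2 = 1) (he : e ^ 2 = 1)
    (hb : b = a ∨ b = a + 4) : a + (b + 2 * e) = 0 ∨ a + (b + 2 * e + 4 * c) = 0 := by
  rcases hb with h | h <;> rw [h] <;> clear h <;> revert a c e <;> decide

theorem zmod8_odd (a d b : ZMod (2 ^ 3)) (ha : a ^ 2 = 1) (hd : d ^ 2 = 1) (hb : b ^ 2 = 1) :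
    (a + (d + 4 * b) = 0 ∨ a + d = 0) ∨ (d = a ∨ d = a + 4) := by
  revert a d b
  decide

theorem zmod8_quintuple (a b c d e : ZMod (2 ^ 3)) (ha : a ^ 2 = 1) (he : e ^ 2 = 1)
    (hb : b = a ∨ b = a + 4) (hc : c = a ∨ c = a + 4) (hd : d = a ∨ d = a + 4) :
    a + (b + c + d) = 0 ∨ a + (b + c + d + 4 * e) = 0 := by
  rcases hb with h | h <;> rw [h] <;> clear h <;> rcases hc with h | h <;> rw [h] <;> clear h <;>
    rcases hd with h | h <;> rw [h] <;> clear h <;> revert a e <;> decide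

/-- A quinary diagonal form over `ℚ_2` with three odd coefficients is isotropic. -/
theorem two_adic_quinary_isotropic (u : Fin 5 → ℤ_[2]) (hu : ∀ i, ‖u i‖ = 1) (d e : Bool) :
    ∃ x : Fin 5 → ℚ_[2], x ≠ 0 ∧
      u 0 * x 0 ^ 2 + u 1 * x 1 ^ 2 + u 2 * x 2 ^ 2 + (if d then 2 else 1) * u 3 * x 3 ^ 2 +
        (if e then 2 else 1) * u 4 * x 4 ^ 2 = 0 := by
  have hs := fun i => toZModPow_three_sq (u i) (hu i)
  have key : ∀ (i : Fin 5) (w : ℤ_[2]),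
      PadicInt.toZModPow 3 (u i) + PadicInt.toZModPow 3 w = 0 →
      ∃ t : ℚ_[2], t ≠ 0 ∧ (u i : ℚ_[2]) * t ^ 2 + w = 0 := fun i w h =>
    two_adic_exists_sq _ _ (hs i) (by rw [map_add]; exact h)
  have h0 : ∀ (x : Fin 5 → ℚ_[2]) (i : Fin 5), x i ≠ 0 → x ≠ 0 := fun x i hi h => hi (by simp [h])
  have c2 : ((2 : ℤ_[2]) : ℚ_[2]) = 2 := by norm_cast
  have m2 : PadicInt.toZModPow (p := 2) 3 2 = 2 := map_ofNat _ 2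
  have m4 : PadicInt.toZModPow (p := 2) 3 4 = 4 := map_ofNat _ 4
  have c4 : ((4 : ℤ_[2]) : ℚ_[2]) = 4 := by norm_cast
  rcases zmod8_pairs _ _ _ (hs 0) (hs 1) (hs 2) with (h | h) | (h | h) | (h | h) | ⟨hb, hc⟩
  · obtain ⟨t, ht, h⟩ := key 0 (u 1 + 4 * u 2) (by simpa [m2, m4] using h)
    refine ⟨![t, 1, 2, 0, 0], h0 _ 0 ht, ?_⟩
    push_cast [c2, c4] at h
    simp; linear_combination h
  · obtain ⟨t, ht, h⟩ := key 0 (u 1) (by simpa [m2, m4] using h)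
    refine ⟨![t, 1, 0, 0, 0], h0 _ 0 ht, ?_⟩
    simp; linear_combination h
  · obtain ⟨t, ht, h⟩ := key 0 (u 2 + 4 * u 1) (by simpa [m2, m4] using h)
    refine ⟨![t, 2, 1, 0, 0], h0 _ 0 ht, ?_⟩
    push_cast [c2, c4] at h
    simp; linear_combination h
  · obtain ⟨t, ht, h⟩ := key 0 (u 2) (by simpa [m2, m4] using h)
    refine ⟨![t, 0, 1, 0, 0], h0 _ 0 ht, ?_⟩
    simp; linear_combination h
  · obtain ⟨t, ht, h⟩ := key 1 (u 2 + 4 * u 0) (by simpa [m2, m4] using h)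
    refine ⟨![2, t, 1, 0, 0], h0 _ 1 ht, ?_⟩
    push_cast [c2, c4] at h
    simp; linear_combination h
  · obtain ⟨t, ht, h⟩ := key 1 (u 2) (by simpa [m2, m4] using h)
    refine ⟨![0, t, 1, 0, 0], h0 _ 1 ht, ?_⟩
    simp; linear_combination h
  cases d with
  | true =>
    rcases zmod8_even _ _ _ _ (hs 0) (hs 2) (hs 3) hb with h | h
    · obtain ⟨t, ht, h⟩ := key 0 (u 1 + 2 * u 3) (by simpa [m2, m4] using h)
      refine ⟨![t, 1, 0, 1, 0], h0 _ 0 ht, ?_⟩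
      push_cast [c2, c4] at h
      simp; linear_combination h
    · obtain ⟨t, ht, h⟩ := key 0 (u 1 + 2 * u 3 + 4 * u 2) (by simpa [m2, m4] using h)
      refine ⟨![t, 1, 2, 1, 0], h0 _ 0 ht, ?_⟩
      push_cast [c2, c4] at h
      simp; linear_combination h
  | false =>
  cases e with
  | true =>
    rcases zmod8_even _ _ _ _ (hs 0) (hs 2) (hs 4) hb with h | h
    · obtain ⟨t, ht, h⟩ := key 0 (u 1 + 2 * u 4) (by simpa [m2, m4] using h)
      refine ⟨![t, 1, 0, 0, 1], h0 _ 0 ht, ?_⟩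
      push_cast [c2, c4] at h
      simp; linear_combination h
    · obtain ⟨t, ht, h⟩ := key 0 (u 1 + 2 * u 4 + 4 * u 2) (by simpa [m2, m4] using h)
      refine ⟨![t, 1, 2, 0, 1], h0 _ 0 ht, ?_⟩
      push_cast [c2, c4] at h
      simp; linear_combination h
  | false =>
    rcases zmod8_odd _ _ _ (hs 0) (hs 3) (hs 1) with (h | h) | hd
    · obtain ⟨t, ht, h⟩ := key 0 (u 3 + 4 * u 1) (by simpa [m2, m4] using h)
      refine ⟨![t, 2, 0, 1, 0], h0 _ 0 ht, ?_⟩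
      push_cast [c2, c4] at h
      simp; linear_combination h
    · obtain ⟨t, ht, h⟩ := key 0 (u 3) (by simpa [m2, m4] using h)
      refine ⟨![t, 0, 0, 1, 0], h0 _ 0 ht, ?_⟩
      simp; linear_combination h
    · rcases zmod8_quintuple _ _ _ _ _ (hs 0) (hs 4) hb hc hd with h | h
      · obtain ⟨t, ht, h⟩ := key 0 (u 1 + u 2 + u 3) (by simpa [m2, m4] using h)
        refine ⟨![t, 1, 1, 1, 0], h0 _ 0 ht, ?_⟩
        push_cast [c2, c4] at h
        simp; linear_combination h
      · obtain ⟨t, ht, h⟩ := key 0 (u 1 + u 2 + u 3 + 4 * u 4) (by simpa [m2, m4] using h)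
        refine ⟨![t, 1, 1, 1, 2], h0 _ 0 ht, ?_⟩
        push_cast [c2, c4] at h
        simp; linear_combination h

/-- Every diagonal form of rank `5` over `ℚ_p` is isotropic. -/
theorem padic_quinary_isotropic {p : ℕ} [hp : Fact p.Prime] (a : Fin 5 → ℚ_[p])
    (ha : ∀ i, a i ≠ 0) : Isotropic a := by
  have hp0 : (p : ℚ_[p]) ≠ 0 := by exact_mod_cast hp.out.ne_zero
  choose u e s hu hs hus using fun i => exists_unit_mul_sq (a i) (ha i)
  obtain ⟨σ, h1, h2⟩ := exists_perm_three_equal e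
  refine Isotropic.perm σ ?_
  -- normalise the three equal exponents to zero
  suffices H : Isotropic fun i : Fin 5 =>
      (if e (σ i) = e (σ 0) then (1 : ℚ_[p]) else p) * u (σ i) by
    cases h0 : e (σ 0) with
    | false =>
      refine Isotropic.of_mul_sq (fun i => s (σ i)) (fun i => hs _) (fun i => ?_) H
      simp only [Function.comp_apply, h0]
      rw [hus (σ i)]
      cases e (σ i) <;> simp
    | true =>
      -- The common exponent is 1: scaling the form by p turns these coefficients into units times
      -- p², and the factor p is absorbed into the square part.
      refine Isotropic.of_mul (p : ℚ_[p]) hp0 (fun i => rfl) ?_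
      refine Isotropic.of_mul_sq (fun i => if e (σ i) = true then p * s (σ i) else s (σ i))
        (fun i => ?_) (fun i => ?_) H
      · split_ifs
        · exact mul_ne_zero hp0 (hs _)
        · exact hs _
      · simp only [Function.comp_apply, h0]
        rw [hus (σ i)]
        cases e (σ i) <;> simp <;> ring
  by_cases hp2 : p = 2
  · subst hp2
    obtain ⟨x, hx, h⟩ := two_adic_quinary_isotropic (fun i => u (σ i)) (fun i => hu _)
      (!decide (e (σ 3) = e (σ 0))) (!decide (e (σ 4) = e (σ 0)))
    refine ⟨x, hx, ?_⟩
    rw [Fin.sum_univ_five, ← h]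
    simp only [h1, h2, if_true, one_mul, Bool.not_eq_true', decide_eq_false_iff_not, ite_not]
    norm_num
  · obtain ⟨x, y, t, ht, h⟩ := ternary_units_isotropic hp2 _ _ _ (hu (σ 0)) (hu (σ 1)) (hu (σ 2))
    refine ⟨![x, y, t, 0, 0], fun h' => ht (by simpa using congrFun h' 2), ?_⟩
    rw [Fin.sum_univ_five]
    simp [h1, h2]
    linear_combination h

/-- Every nondegenerate diagonal form of rank `4` over `ℚ_p` is universal. -/
theorem padic_quaternary_universal {p : ℕ} [hp : Fact p.Prime] (a : Fin 4 → ℚ_[p])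
    (ha : ∀ i, a i ≠ 0) (t : ℚ_[p]) (ht : t ≠ 0) : ∃ x : Fin 4 → ℚ_[p], ∑ i, a i * x i ^ 2 = t := by
  obtain ⟨x, hx, h⟩ := padic_quinary_isotropic (Fin.snoc a (-t) : Fin 5 → ℚ_[p]) (fun i => by
    refine Fin.lastCases ?_ (fun j => ?_) i
    · rw [Fin.snoc_last]; exact neg_ne_zero.2 ht
    · simpa using ha j)
  rw [Fin.sum_univ_castSucc] at h
  simp only [Fin.snoc_castSucc, Fin.snoc_last] at h
  -- A quinary zero with vanishing last coordinate makes the quaternary form isotropic, hence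
  -- universal; otherwise dividing by that coordinate solves the equation.
  by_cases h4 : x (Fin.last 4) = 0
  · refine Isotropic.universal two_ne_zero ha ⟨fun i => x i.castSucc, ?_, by rw [h4] at h; simpa using h⟩ t
    intro h0
    apply hx
    funext i
    refine Fin.lastCases h4 (fun j => congrFun h0 j) i
  · refine ⟨fun i => x i.castSucc / x (Fin.last 4), ?_⟩
    simp only [div_pow, mul_div_assoc', ← Finset.sum_div]
    rw [div_eq_iff (pow_ne_zero 2 h4)]
    linear_combination h

/-! ### Legendre's theorem -/

/-- The form `x² - a y² - b z²` has a nontrivial zero over `K`. -/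
def HilbertSolvable {K : Type*} [Field K] (a b : K) : Prop :=
  ∃ x y z : K, (x ≠ 0 ∨ y ≠ 0 ∨ z ≠ 0) ∧ x ^ 2 = a * y ^ 2 + b * z ^ 2

section HilbertSolvable
variable {K : Type*} [Field K] {a b : K}

theorem HilbertSolvable.symm (h : HilbertSolvable a b) : HilbertSolvable b a := by
  obtain ⟨x, y, z, h0, h⟩ := h
  exact ⟨x, z, y, by tauto, by rw [h]; ring⟩

theorem HilbertSolvable.mul_sq {c : K} (hc : c ≠ 0) (h : HilbertSolvable a b) :
    HilbertSolvable a (b * c ^ 2) := by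
  obtain ⟨x, y, z, h0, h⟩ := h
  refine ⟨x, y, z / c, ?_, ?_⟩
  · simpa [hc] using h0
  · rw [h]; field_simp

theorem HilbertSolvable.of_mul_sq {c : K} (hc : c ≠ 0) (h : HilbertSolvable a (b * c ^ 2)) :
    HilbertSolvable a b := by
  have := h.mul_sq (inv_ne_zero hc)
  rwa [mul_assoc, ← mul_pow, mul_inv_cancel₀ hc, one_pow, mul_one] at this

/-- Since b b' is the norm of t + √a, multiplying x + y√a by t + √a turns a representation of b z²
as a norm into one of b' (b z)². This is the descent step, used in both directions. -/
theorem HilbertSolvable.of_norm {b' t : K} (hb : b ≠ 0) (ht : b * b' = t ^ 2 - a)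
    (h : HilbertSolvable a b) : HilbertSolvable a b' := by
  obtain ⟨x, y, z, h0, h⟩ := h
  by_cases hz : z = 0
  · subst hz
    exact ⟨x, y, 0, h0, by simpa using h⟩
  · refine ⟨t * x + a * y, x + t * y, b * z, by simp [hb, hz], ?_⟩
    linear_combination (t ^ 2 - a) * h - b * z ^ 2 * ht

end HilbertSolvable

theorem padic_exists_primitive {p : ℕ} [hp : Fact p.Prime] (x y z : ℚ_[p])
    (h : x ≠ 0 ∨ y ≠ 0 ∨ z ≠ 0) : ∃ (s : ℚ_[p]) (X Y Z : ℤ_[p]), s ≠ 0 ∧ x = s * X ∧ y = s * Y ∧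
      z = s * Z ∧ (‖X‖ = 1 ∨ ‖Y‖ = 1 ∨ ‖Z‖ = 1) := by
  have key : ∀ s : ℚ_[p], s ≠ 0 → ‖x‖ ≤ ‖s‖ → ‖y‖ ≤ ‖s‖ → ‖z‖ ≤ ‖s‖ →
      (s = x ∨ s = y ∨ s = z) → ∃ (s : ℚ_[p]) (X Y Z : ℤ_[p]), s ≠ 0 ∧ x = s * X ∧ y = s * Y ∧
      z = s * Z ∧ (‖X‖ = 1 ∨ ‖Y‖ = 1 ∨ ‖Z‖ = 1) := by
    intro s hs hx hy hz h
    have hn : ∀ w : ℚ_[p], ‖w‖ ≤ ‖s‖ → ‖w / s‖ ≤ 1 := fun w hw => by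
      rw [norm_div]; exact div_le_one_of_le₀ hw (norm_nonneg _)
    refine ⟨s, ⟨x / s, hn x hx⟩, ⟨y / s, hn y hy⟩, ⟨z / s, hn z hz⟩, hs,
      (mul_div_cancel₀ _ hs).symm, (mul_div_cancel₀ _ hs).symm, (mul_div_cancel₀ _ hs).symm, ?_⟩
    rcases h with rfl | rfl | rfl <;> simp [div_self hs]
  have pos : ∀ s : ℚ_[p], ‖x‖ ≤ ‖s‖ → ‖y‖ ≤ ‖s‖ → ‖z‖ ≤ ‖s‖ → s ≠ 0 := by
    rintro s hx hy hz rfl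
    simp only [norm_zero, norm_le_zero_iff] at hx hy hz
    tauto
  rcases le_total ‖x‖ ‖y‖ with h1 | h1 <;> rcases le_total ‖y‖ ‖z‖ with h2 | h2 <;>
    rcases le_total ‖x‖ ‖z‖ with h3 | h3
  · exact key z (pos z h3 h2 le_rfl) h3 h2 le_rfl (by tauto)
  · exact key z (pos z (h1.trans h2) h2 le_rfl) (h1.trans h2) h2 le_rfl (by tauto)
  · exact key y (pos y h1 le_rfl h2) h1 le_rfl h2 (by tauto)
  · exact key y (pos y h1 le_rfl h2) h1 le_rfl h2 (by tauto)
  · exact key z (pos z h3 h2 le_rfl) h3 h2 le_rfl (by tauto)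
  · exact key x (pos x le_rfl h1 h3) le_rfl h1 h3 (by tauto)
  · exact key x (pos x le_rfl h1 (h2.trans h1)) le_rfl h1 (h2.trans h1) (by tauto)
  · exact key x (pos x le_rfl h1 h3) le_rfl h1 h3 (by tauto)

theorem HilbertSolvable.exists_padicInt {p : ℕ} [hp : Fact p.Prime] {a b : ℤ}
    (h : HilbertSolvable (a : ℚ_[p]) (b : ℚ_[p])) : ∃ X Y Z : ℤ_[p],
      X ^ 2 = a * Y ^ 2 + b * Z ^ 2 ∧ (‖X‖ = 1 ∨ ‖Y‖ = 1 ∨ ‖Z‖ = 1) := by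
  obtain ⟨x, y, z, h0, h⟩ := h
  obtain ⟨s, X, Y, Z, hs, rfl, rfl, rfl, hn⟩ := padic_exists_primitive x y z h0
  refine ⟨X, Y, Z, ?_, hn⟩
  have : s ^ 2 * ((X : ℚ_[p]) ^ 2 - (a * Y ^ 2 + b * Z ^ 2)) = 0 := by linear_combination h
  have := (mul_eq_zero.1 this).resolve_left (pow_ne_zero 2 hs)
  apply Subtype.coe_injective
  push_cast
  linear_combination this

/-- Modulo 4 a sum of three squares, one of them odd, is never 0. -/
theorem not_hilbertSolvable_neg_one : ¬ HilbertSolvable ((-1 : ℤ) : ℚ_[2]) ((-1 : ℤ) : ℚ_[2]) := by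
  intro h
  obtain ⟨X, Y, Z, h, hn⟩ := h.exists_padicInt
  have hs : ∀ a : ℤ_[2], ‖a‖ = 1 → PadicInt.toZModPow 2 a ^ 2 = 1 := by
    intro a ha
    have := toZModPow_three_sq a ha
    rw [← PadicInt.zmod_cast_comp_toZModPow 2 3 (by norm_num), RingHom.comp_apply]
    rw [← map_pow, this, map_one]
  have h' := congrArg (PadicInt.toZModPow 2) h
  simp only [map_add, map_mul, map_pow, Int.cast_neg, Int.cast_one, map_neg,
    map_one] at h'
  have hn' : PadicInt.toZModPow 2 X ^ 2 = 1 ∨ PadicInt.toZModPow 2 Y ^ 2 = 1 ∨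
      PadicInt.toZModPow 2 Z ^ 2 = 1 := hn.imp (hs X) (Or.imp (hs Y) (hs Z))
  revert h' hn'
  generalize PadicInt.toZModPow 2 X = x
  generalize PadicInt.toZModPow 2 Y = y
  generalize PadicInt.toZModPow 2 Z = z
  revert x y z
  decide

/-- A primitive solution satisfies X² ≡ a Y² modulo p. If p divided Y it would divide X, and then Z
because p divides b exactly once, against primitivity. So X/Y is a square root of a modulo p. -/
theorem HilbertSolvable.exists_sq_modEq {p : ℕ} [hp : Fact p.Prime] {a b : ℤ} (hb : (p : ℤ) ∣ b)
    (hb2 : ¬ (p : ℤ) ^ 2 ∣ b) (h : HilbertSolvable (a : ℚ_[p]) (b : ℚ_[p])) :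
    ∃ t : ℤ, (p : ℤ) ∣ t ^ 2 - a := by
  obtain ⟨X, Y, Z, h, hn⟩ := h.exists_padicInt
  have hker : ∀ z : ℤ_[p], PadicInt.toZMod z = 0 ↔ (p : ℤ_[p]) ∣ z := by
    intro z
    rw [← RingHom.mem_ker, PadicInt.ker_toZMod, PadicInt.maximalIdeal_eq_span_p,
      Ideal.mem_span_singleton]
  have h' := congrArg (PadicInt.toZMod (p := p)) h
  simp only [map_add, map_mul, map_pow, map_intCast,
    (ZMod.intCast_zmod_eq_zero_iff_dvd b p).2 hb, zero_mul, add_zero] at h'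
  by_cases hY : PadicInt.toZMod Y = 0
  · exfalso
    have hX : PadicInt.toZMod X = 0 := by
      rw [hY] at h'
      simpa using h'
    obtain ⟨y, rfl⟩ := (hker Y).1 hY
    obtain ⟨x, rfl⟩ := (hker X).1 hX
    obtain ⟨c, rfl⟩ := hb
    have hp0 : (p : ℤ_[p]) ≠ 0 := by exact_mod_cast hp.out.ne_zero
    have h3 : (c : ℤ_[p]) * Z ^ 2 = p * (x ^ 2 - a * y ^ 2) := by
      apply mul_left_cancel₀ hp0
      push_cast at h
      linear_combination -h
    have h4 := congrArg (PadicInt.toZMod (p := p)) h3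
    simp only [map_mul, map_pow, map_intCast, map_natCast, CharP.cast_eq_zero, zero_mul] at h4
    have hc : (c : ZMod p) ≠ 0 := by
      rw [Ne, ZMod.intCast_zmod_eq_zero_iff_dvd]
      intro hc
      exact hb2 (by rw [pow_two]; exact mul_dvd_mul_left _ hc)
    have hZ : PadicInt.toZMod Z = 0 := by simpa [hc] using h4
    have hZ' := (hker Z).1 hZ
    have hX' := (hker _).1 hX
    have hY' := (hker _).1 hY
    rw [← PadicInt.norm_lt_one_iff_dvd] at hZ' hX' hY'
    rcases hn with h | h | h <;> linarith
  · obtain ⟨t, ht⟩ := ZMod.intCast_surjective (PadicInt.toZMod X / PadicInt.toZMod Y)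
    refine ⟨t, ?_⟩
    rw [← ZMod.intCast_zmod_eq_zero_iff_dvd]
    push_cast
    rw [ht, div_pow, h']
    field_simp
    ring

theorem exists_sq_modEq_of_squarefree (a : ℤ) (n : ℕ) (hn : Squarefree n)
    (h : ∀ p : ℕ, p.Prime → p ∣ n → ∃ t : ℤ, (p : ℤ) ∣ t ^ 2 - a) :
    ∃ t : ℤ, (n : ℤ) ∣ t ^ 2 - a := by
  induction n using Nat.recOnMul with
  | zero => exact absurd hn not_squarefree_zero
  | one => exact ⟨0, by simp⟩
  | prime p hp => exact h p hp dvd_rfl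
  | mul m n ihm ihn =>
    have hc := Nat.coprime_of_squarefree_mul hn
    obtain ⟨s, hs⟩ := ihm (hn.squarefree_of_dvd (dvd_mul_right _ _))
      fun p hp hd => h p hp (hd.mul_right _)
    obtain ⟨t, ht⟩ := ihn (hn.squarefree_of_dvd (dvd_mul_left _ _))
      fun p hp hd => h p hp (hd.mul_left _)
    have hc' : IsCoprime (m : ℤ) (n : ℤ) := Nat.isCoprime_iff_coprime.2 hc
    obtain ⟨u, v, huv⟩ := hc'
    refine ⟨s * (v * n) + t * (u * m), ?_⟩
    push_cast
    refine IsCoprime.mul_dvd ⟨u, v, huv⟩ ?_ ?_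
    · have : (s * (v * n) + t * (u * m)) ^ 2 - a = (s ^ 2 - a) +
        m * (u * (t - s)) * (s * (v * n) + t * (u * m) + s) := by
        linear_combination s * (s * (v * n) + t * (u * m) + s) * huv
      rw [this]
      exact dvd_add hs (dvd_mul_of_dvd_left (dvd_mul_right _ _) _)
    · have : (s * (v * n) + t * (u * m)) ^ 2 - a = (t ^ 2 - a) +
        n * (v * (s - t)) * (s * (v * n) + t * (u * m) + t) := by
        linear_combination t * (s * (v * n) + t * (u * m) + t) * huv
      rw [this]
      exact dvd_add ht (dvd_mul_of_dvd_left (dvd_mul_right _ _) _)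

/-- Legendre's theorem: solvability over every `ℚ_p` implies solvability over `ℚ`. -/
theorem hilbertSolvable_rat_of_padic (a b : ℤ) (ha : a ≠ 0) (hb : b ≠ 0)
    (h : ∀ (p : ℕ) [Fact p.Prime], HilbertSolvable (a : ℚ_[p]) (b : ℚ_[p])) :
    HilbertSolvable (a : ℚ) (b : ℚ) := by
  induction hm : a.natAbs + b.natAbs using Nat.strong_induction_on generalizing a b with
  | _ m ih =>
  wlog hab : a.natAbs ≤ b.natAbs generalizing a b
  · exact (this b a hb ha (fun p _ => (h p).symm) (by omega) (by omega)).symm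
  by_cases h1 : b.natAbs = 1
  · have ha1 : a = 1 ∨ a = -1 := by omega
    have hb1 : b = 1 ∨ b = -1 := by omega
    rcases ha1 with rfl | rfl
    · exact ⟨1, 1, 0, by simp, by simp⟩
    rcases hb1 with rfl | rfl
    · exact ⟨1, 0, 1, by simp, by simp⟩
    · exact absurd (h 2) not_hilbertSolvable_neg_one
  by_cases hsq : Squarefree b.natAbs
  · obtain ⟨t₀, ht₀⟩ := exists_sq_modEq_of_squarefree a b.natAbs hsq (fun p hp hpb => by
      have := Fact.mk hp
      refine (h p).exists_sq_modEq (Int.natCast_dvd.2 hpb) fun h2 => ?_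
      have h2 : p ^ 2 ∣ b.natAbs := by
        rw [← Int.natCast_dvd]; exact_mod_cast h2
      exact hp.one_lt.ne' (Nat.isUnit_iff.1 (hsq p (by rwa [← pow_two]))))
    rw [Int.natAbs_dvd] at ht₀
    -- With 0 ≤ t < |b|, |a| ≤ |b| and |b| ≥ 2, the bound (|b| - 1)² + |b| < |b|² makes the cofactor
    -- b' of t² - a = b b' smaller than b.
    set t := t₀ % b with htdef
    have ht : b ∣ t ^ 2 - a := by
      have : t ^ 2 - a = (t₀ ^ 2 - a) - b * (t₀ / b * (t₀ + t)) := by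
        have := Int.emod_add_mul_ediv t₀ b
        linear_combination (t₀ + t) * this
      rw [this]
      exact dvd_sub ht₀ (dvd_mul_right _ _)
    have ht0 : 0 ≤ t := Int.emod_nonneg _ hb
    have htb : t < |b| := Int.emod_lt_abs _ hb
    obtain ⟨b', hb'⟩ := ht
    by_cases hb0 : b' = 0
    · refine ⟨t, 1, 0, by simp, ?_⟩
      have : t ^ 2 = a := by rw [hb0] at hb'; linarith
      rw [← this]; push_cast; ring
    have hlt : b'.natAbs < b.natAbs := by
      have h2 : 2 ≤ |b| := by
        rw [Int.abs_eq_natAbs]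
        have := Int.natAbs_ne_zero.2 hb
        omega
      have haa : |a| ≤ |b| := by rw [Int.abs_eq_natAbs, Int.abs_eq_natAbs]; exact_mod_cast hab
      have : |b| * |b'| < |b| * |b| := by
        rw [← abs_mul, ← hb']
        have h4 : |t ^ 2 - a| ≤ t ^ 2 + |a| := by
          have := abs_sub (t ^ 2) a
          rwa [abs_of_nonneg (sq_nonneg t)] at this
        nlinarith
      have := lt_of_mul_lt_mul_left this (abs_nonneg b)
      rw [Int.abs_eq_natAbs, Int.abs_eq_natAbs] at this
      exact_mod_cast this
    have := ih (a.natAbs + b'.natAbs) (by omega) a b' ha hb0 (fun p _ => by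
      refine HilbertSolvable.of_norm (b := (b : ℚ_[p])) (t := t) (by exact_mod_cast hb) ?_ (h p)
      exact_mod_cast hb'.symm) rfl
    refine this.of_norm (t := (t : ℚ)) (by exact_mod_cast hb0) ?_
    have : b' * b = t ^ 2 - a := by rw [hb']; ring
    exact_mod_cast this
  -- A square factor p² of b does not affect solvability and can be removed.
  · rw [Nat.squarefree_iff_prime_squarefree] at hsq
    push Not at hsq
    obtain ⟨p, hp, hpb⟩ := hsq
    obtain ⟨c, hc⟩ := Int.natCast_dvd.2 hpb
    have hbc : b = c * (p : ℤ) ^ 2 := by rw [hc]; push_cast; ring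
    have hc0 : c ≠ 0 := by rintro rfl; simp at hc; exact hb hc
    have hp0 : (p : ℤ) ≠ 0 := by exact_mod_cast hp.ne_zero
    have hlt : c.natAbs < b.natAbs := by
      rw [hc, Int.natAbs_mul, Int.natAbs_natCast]
      have := hp.two_le
      have : 0 < c.natAbs := by omega
      have : 2 * 2 ≤ p * p := Nat.mul_le_mul hp.two_le hp.two_le
      nlinarith
    have := ih (a.natAbs + c.natAbs) (by omega) a c ha hc0 (fun q _ => by
      refine HilbertSolvable.of_mul_sq (c := ((p : ℤ) : ℚ_[q])) (by exact_mod_cast hp0) ?_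
      have := h q
      rw [hbc] at this
      exact_mod_cast this) rfl
    have := this.mul_sq (c := ((p : ℤ) : ℚ)) (by exact_mod_cast hp0)
    rw [hbc]
    exact_mod_cast this

/-! ### The local obstruction for ternary forms -/

/-- Put D = z² + a b s². The identity (a x² + b y²) D = a (x z + b y s)² + b (y z - a x s)² turns
the relation, multiplied by D, into a zero with third coordinate D. If D = 0 the first two
coefficients alone give a zero. Thus an anisotropic ternary form misses minus its determinant. -/
theorem ternary_zero_of_mul_det {K : Type*} [Field K] {a b c x y z s : K}
    (hb : b ≠ 0) (hs : s ≠ 0)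
    (h : a * x ^ 2 + b * y ^ 2 + c * z ^ 2 + a * b * c * s ^ 2 = 0) :
    ∃ X Y Z : K, (X ≠ 0 ∨ Y ≠ 0 ∨ Z ≠ 0) ∧ a * X ^ 2 + b * Y ^ 2 + c * Z ^ 2 = 0 := by
  by_cases hD : z ^ 2 + a * b * s ^ 2 = 0
  · exact ⟨b * s, z, 0, by simp [hb, hs], by linear_combination b * hD⟩
  · exact ⟨x * z + b * y * s, y * z - a * x * s, z ^ 2 + a * b * s ^ 2, by simp [hD],
      by linear_combination (z ^ 2 + a * b * s ^ 2) * h⟩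

theorem HilbertSolvable.of_ternary_zero {K : Type*} [Field K] {a b c : K} (hc : c ≠ 0)
    (h : ∃ X Y Z : K, (X ≠ 0 ∨ Y ≠ 0 ∨ Z ≠ 0) ∧ a * X ^ 2 + b * Y ^ 2 + c * Z ^ 2 = 0) :
    HilbertSolvable (-(c * a)) (-(c * b)) := by
  obtain ⟨X, Y, Z, h0, h⟩ := h
  exact ⟨c * Z, X, Y, by simpa [hc, or_comm, or_assoc, or_left_comm] using h0,
    by linear_combination c * h⟩

/-- A positive definite ternary form over `ℚ` is anisotropic over some `ℚ_p`. -/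
theorem exists_prime_ternary_anisotropic (a b c : ℚ) (ha : 0 < a) (hb : 0 < b) (hc : 0 < c) :
    ∃ (p : ℕ) (_ : Fact p.Prime), ¬ ∃ X Y Z : ℚ_[p], (X ≠ 0 ∨ Y ≠ 0 ∨ Z ≠ 0) ∧
      (a : ℚ_[p]) * X ^ 2 + b * Y ^ 2 + c * Z ^ 2 = 0 := by
  by_contra hcon
  push Not at hcon
  -- Clearing denominators by a square makes the coefficients integral. Both are negative, so the
  -- rational zero produced by Legendre's theorem must be trivial.
  have hint : ∀ r : ℚ, 0 < r → ∃ (A : ℤ) (d : ℚ), A < 0 ∧ d ≠ 0 ∧ (A : ℚ) = -r * d ^ 2 := by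
    intro r hr
    refine ⟨-(r.num * r.den), r.den, ?_, by exact_mod_cast r.den_ne_zero, ?_⟩
    · have := Rat.num_pos.2 hr
      have := r.den_pos
      simp only [Left.neg_neg_iff]
      positivity
    · have : r * r.den = r.num := Rat.mul_den_eq_num r
      push_cast
      linear_combination (r.den : ℚ) * this
  obtain ⟨A, d, hA, hd, hAd⟩ := hint (c * a) (mul_pos hc ha)
  obtain ⟨B, e, hB, he, hBe⟩ := hint (c * b) (mul_pos hc hb)
  obtain ⟨x, y, z, h0, h⟩ := hilbertSolvable_rat_of_padic A B hA.ne hB.ne (fun p hp => by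
    have hc' : (c : ℚ_[p]) ≠ 0 := by exact_mod_cast hc.ne'
    have h1 := HilbertSolvable.of_ternary_zero hc' (hcon p hp)
    have h2 := (h1.mul_sq (c := (e : ℚ_[p])) (by exact_mod_cast he)).symm.mul_sq
      (c := (d : ℚ_[p])) (by exact_mod_cast hd)
    have e1 : (A : ℚ_[p]) = -(c * a) * d ^ 2 := by exact_mod_cast congrArg (Rat.cast (K := ℚ_[p])) hAd
    have e2 : (B : ℚ_[p]) = -(c * b) * e ^ 2 := by exact_mod_cast congrArg (Rat.cast (K := ℚ_[p])) hBe
    rw [e1, e2]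
    exact h2.symm)
  have hA' : (A : ℚ) < 0 := by exact_mod_cast hA
  have hB' : (B : ℚ) < 0 := by exact_mod_cast hB
  have p1 : 0 ≤ -A * y ^ 2 := mul_nonneg (by linarith) (sq_nonneg _)
  have p2 : 0 ≤ -B * z ^ 2 := mul_nonneg (by linarith) (sq_nonneg _)
  have p3 := sq_nonneg x
  have q3 : x ^ 2 = 0 := by linarith
  have q1 : -A * y ^ 2 = 0 := by linarith
  have q2 : -B * z ^ 2 = 0 := by linarith
  simp [hA.ne, hB.ne] at q1 q2 q3
  tauto

/-- A positive definite quaternary diagonal form over `ℚ` represents a number that a given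
positive definite ternary diagonal form does not represent. -/
theorem exists_value_not_ternary (w : Fin 4 → ℚ) (hw : ∀ i, 0 < w i) (a : Fin 3 → ℚ)
    (ha : ∀ i, 0 < a i) : ∃ x : Fin 4 → ℚ, ∀ y : Fin 3 → ℚ,
      ∑ i, w i * x i ^ 2 ≠ ∑ i, a i * y i ^ 2 := by
  obtain ⟨p, hp, hani⟩ := exists_prime_ternary_anisotropic (a 0) (a 1) (a 2) (ha 0) (ha 1) (ha 2)
  have ha' : ∀ i, (a i : ℚ_[p]) ≠ 0 := fun i => by exact_mod_cast (ha i).ne'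
  have hw' : ∀ i, (w i : ℚ_[p]) ≠ 0 := fun i => by exact_mod_cast (hw i).ne'
  set t : ℚ_[p] := -(a 0 * a 1 * a 2) with ht
  have ht0 : t ≠ 0 := neg_ne_zero.2 (mul_ne_zero (mul_ne_zero (ha' 0) (ha' 1)) (ha' 2))
  obtain ⟨x, hx⟩ := padic_quaternary_universal (fun i => (w i : ℚ_[p])) hw' t ht0
  -- Near the p-adic solution, the value divided by t stays a nonzero square; density of `ℚ`
  -- supplies a rational vector there.
  have hopen : IsOpen {x : Fin 4 → ℚ_[p] |
      ‖(∑ i, (w i : ℚ_[p]) * x i ^ 2) / t - 1‖ < ‖(2 : ℚ_[p])‖ ^ 2} := by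
    refine isOpen_lt (by fun_prop) continuous_const
  have hdense : DenseRange fun (x : Fin 4 → ℚ) (i : Fin 4) => (x i : ℚ_[p]) :=
    DenseRange.piMap fun _ => Padic.denseRange_ratCast p
  obtain ⟨x', hx'⟩ := hdense.exists_mem_open hopen ⟨x, by
    simp only [Set.mem_ofPred_eq, hx, div_self ht0, sub_self, norm_zero]
    have : (2 : ℚ_[p]) ≠ 0 := two_ne_zero
    positivity⟩
  refine ⟨x', fun y hy => hani ?_⟩
  obtain ⟨s, hs⟩ := padic_isSquare_of_norm_sub_one_lt _ hx'
  have hs0 : s ≠ 0 := by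
    rintro rfl
    rw [Set.mem_ofPred_eq, hs] at hx'
    have h2 : ‖(2 : ℚ_[p])‖ ≤ 1 := by simpa using Padic.norm_int_le_one (p := p) 2
    have := pow_le_one₀ (n := 2) (norm_nonneg _) h2
    simp at hx'
    linarith
  refine ternary_zero_of_mul_det (x := (y 0 : ℚ_[p])) (y := y 1) (z := y 2) (ha' 1) hs0 ?_
  have hy' := congrArg (Rat.cast (K := ℚ_[p])) hy
  push_cast at hy'
  rw [hy', div_eq_iff ht0, Fin.sum_univ_three, ht] at hs
  linear_combination hs

/-! ### Positive definite real forms and their rational approximation -/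

theorem _root_.Matrix.PosDef.transpose_eq {ι : Type*} {S : Matrix ι ι ℝ} (hS : S.PosDef) : Sᵀ = S := by
  have := hS.isHermitian
  rwa [Matrix.IsHermitian, Matrix.conjTranspose_eq_transpose_of_trivial] at this

section Real
variable {ι : Type*} [Fintype ι]

theorem dotProduct_mulVec_eq_sum {R : Type*} [CommRing R] (S : Matrix ι ι R) (v : ι → R) :
    v ⬝ᵥ S *ᵥ v = ∑ i, ∑ j, v i * v j * S i j := by
  simp only [dotProduct, Matrix.mulVec, Finset.mul_sum]
  exact Finset.sum_congr rfl fun i _ => Finset.sum_congr rfl fun j _ => by ring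

theorem _root_.Matrix.PosDef.qf_pos {S : Matrix ι ι ℝ} (hS : S.PosDef) {v : ι → ℝ} (hv : v ≠ 0) :
    0 < v ⬝ᵥ S *ᵥ v := by
  simpa using hS.dotProduct_mulVec_pos hv

theorem posDef_of_qf_pos {S : Matrix ι ι ℝ} (hs : Sᵀ = S) (h : ∀ v, v ≠ 0 → 0 < v ⬝ᵥ S *ᵥ v) :
    S.PosDef := by
  refine Matrix.PosDef.of_dotProduct_mulVec_pos ?_ fun v hv => by simpa using h v hv
  rw [Matrix.IsHermitian, Matrix.conjTranspose_eq_transpose_of_trivial, hs]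

/-- A positive definite form is bounded below by a multiple of the square of the sup norm. -/
theorem _root_.Matrix.PosDef.exists_coercive {S : Matrix ι ι ℝ} (hS : S.PosDef) :
    ∃ c : ℝ, 0 < c ∧ ∀ v : ι → ℝ, c * ‖v‖ ^ 2 ≤ v ⬝ᵥ S *ᵥ v := by
  have hcont : Continuous fun v : ι → ℝ => v ⬝ᵥ S *ᵥ v := by
    simp only [dotProduct_mulVec_eq_sum]
    fun_prop
  have hne : ∀ v ∈ Metric.sphere (0 : ι → ℝ) 1, v ≠ 0 := by
    rintro v hv rfl
    simp at hv
  obtain ⟨c, hc, h⟩ : ∃ c : ℝ, 0 < c ∧ ∀ v ∈ Metric.sphere (0 : ι → ℝ) 1, c ≤ v ⬝ᵥ S *ᵥ v := by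
    rcases (Metric.sphere (0 : ι → ℝ) 1).eq_empty_or_nonempty with he | hn
    · exact ⟨1, one_pos, by simp [he]⟩
    · obtain ⟨v, hv, hmin⟩ := (isCompact_sphere (0 : ι → ℝ) 1).exists_isMinOn hn hcont.continuousOn
      exact ⟨_, hS.qf_pos (hne v hv), fun w hw => hmin hw⟩
  refine ⟨c, hc, fun v => ?_⟩
  by_cases hv : v = 0
  · simp [hv]
  have hn : ‖v‖ ≠ 0 := norm_ne_zero_iff.2 hv
  have h1 := h (‖v‖⁻¹ • v) (by simp [norm_smul, hn])
  rw [Matrix.mulVec_smul, dotProduct_smul, smul_dotProduct, smul_eq_mul, smul_eq_mul] at h1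
  have h2 : ‖v‖ ^ 2 * (‖v‖⁻¹ * (‖v‖⁻¹ * (v ⬝ᵥ S *ᵥ v))) = v ⬝ᵥ S *ᵥ v := by field_simp
  nlinarith [mul_le_mul_of_nonneg_left h1 (sq_nonneg ‖v‖)]

/-- Positive definiteness is stable under small symmetric perturbations. -/
theorem _root_.Matrix.PosDef.exists_near {S : Matrix ι ι ℝ} (hS : S.PosDef) :
    ∃ ε : ℝ, 0 < ε ∧ ∀ T : Matrix ι ι ℝ, Tᵀ = T → (∀ i j, |T i j - S i j| < ε) → T.PosDef := by
  obtain ⟨c, hc, h⟩ := hS.exists_coercive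
  set n : ℝ := (Fintype.card ι : ℝ) with hn
  have hn0 : 0 ≤ n := Nat.cast_nonneg _
  refine ⟨c / (n ^ 2 + 1), by positivity, fun T hT hd => posDef_of_qf_pos hT fun v hv => ?_⟩
  have hv' : 0 < ‖v‖ := norm_pos_iff.2 hv
  have h1 : v ⬝ᵥ T *ᵥ v - v ⬝ᵥ S *ᵥ v = ∑ i, ∑ j, v i * v j * (T i j - S i j) := by
    simp only [dotProduct_mulVec_eq_sum, mul_sub, Finset.sum_sub_distrib]
  have h2 : |∑ i, ∑ j, v i * v j * (T i j - S i j)| ≤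
      ∑ i : ι, ∑ j : ι, ‖v‖ ^ 2 * (c / (n ^ 2 + 1)) := by
    refine (Finset.abs_sum_le_sum_abs _ _).trans (Finset.sum_le_sum fun i _ => ?_)
    refine (Finset.abs_sum_le_sum_abs _ _).trans (Finset.sum_le_sum fun j _ => ?_)
    rw [abs_mul, abs_mul, pow_two]
    have hi : |v i| ≤ ‖v‖ := norm_le_pi_norm v i
    have hj : |v j| ≤ ‖v‖ := norm_le_pi_norm v j
    gcongr
    exact (hd i j).le
  simp only [Finset.sum_const, Finset.card_univ, nsmul_eq_mul, ← hn] at h2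
  have h3 : n * (n * (‖v‖ ^ 2 * (c / (n ^ 2 + 1)))) < c * ‖v‖ ^ 2 := by
    have : n * (n * (‖v‖ ^ 2 * (c / (n ^ 2 + 1)))) = c * ‖v‖ ^ 2 * (n ^ 2 / (n ^ 2 + 1)) := by
      field_simp
    rw [this]
    have : n ^ 2 / (n ^ 2 + 1) < 1 := by rw [div_lt_one (by positivity)]; linarith
    have h0 : 0 < c * ‖v‖ ^ 2 := by positivity
    nlinarith
  have := h v
  rw [← h1] at h2
  have := neg_abs_le (v ⬝ᵥ T *ᵥ v - v ⬝ᵥ S *ᵥ v)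
  linarith

end Real

/-- Finitely many real numbers are approximated by a `ℚ`-linear map to `ℚ`. -/
theorem exists_rat_linearMap_near (E : Set ℝ) (hE : E.Finite) (ε : ℝ) (hε : 0 < ε) :
    ∃ φ : ℝ →ₗ[ℚ] ℚ, ∀ x ∈ E, |(φ x : ℝ) - x| < ε := by
  set W := Submodule.span ℚ E with hW
  have : Module.Finite ℚ W := Module.Finite.span_of_finite ℚ hE
  let b := Module.finBasis ℚ W
  have hopen : IsOpen {ρ : Fin (Module.finrank ℚ W) → ℝ |
      ∀ x ∈ {y : W | (y : ℝ) ∈ E}, |(∑ i, (b.repr x i : ℝ) * ρ i) - (x : ℝ)| < ε} := by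
    have hfin : {y : W | (y : ℝ) ∈ E}.Finite := hE.preimage Subtype.coe_injective.injOn
    have : {ρ : Fin (Module.finrank ℚ W) → ℝ |
      ∀ x ∈ {y : W | (y : ℝ) ∈ E}, |(∑ i, (b.repr x i : ℝ) * ρ i) - (x : ℝ)| < ε} =
      ⋂ x ∈ {y : W | (y : ℝ) ∈ E}, {ρ | |(∑ i, (b.repr x i : ℝ) * ρ i) - (x : ℝ)| < ε} := by
      ext ρ; simp
    rw [this]
    exact hfin.isOpen_biInter fun x _ => isOpen_lt (by fun_prop) continuous_const
  have hdense : DenseRange fun (x : Fin (Module.finrank ℚ W) → ℚ) i => ((x i : ℚ) : ℝ) :=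
    DenseRange.piMap fun _ => Rat.denseRange_cast
  -- A linear map on the span is given by the images ρ of a `ℚ`-basis. The inclusion into `ℝ` is the
  -- real point with error 0, and nearby points with rational coordinates give maps to `ℚ`.
  obtain ⟨ρ, hρ⟩ := hdense.exists_mem_open hopen ⟨fun i => (b i : ℝ), fun x _ => by
    have h := congrArg (Submodule.subtype W) (b.sum_repr x)
    rw [map_sum] at h
    simp only [map_smul, Submodule.subtype_apply, Rat.smul_def] at h
    rw [h, sub_self, abs_zero]
    exact hε⟩
  obtain ⟨φ, hφ⟩ := (b.constr ℚ ρ).exists_extend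
  refine ⟨φ, fun x hx => ?_⟩
  have hxW : x ∈ W := Submodule.subset_span hx
  have h1 : φ x = ∑ i, b.repr ⟨x, hxW⟩ i * ρ i := by
    have := LinearMap.congr_fun hφ ⟨x, hxW⟩
    rw [Module.Basis.constr_apply_fintype] at this
    simpa [Module.Basis.equivFun_apply] using this
  have := hρ ⟨x, hxW⟩ hx
  rw [h1]
  push_cast
  exact this

theorem exists_diagonal_rat {ι : Type*} [Fintype ι] {n : ℕ} (hn : Fintype.card ι = n)
    (T : Matrix ι ι ℚ) (hT : ∀ x, x ≠ 0 → 0 < x ⬝ᵥ T *ᵥ x) :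
    ∃ (w : Fin n → ℚ) (f : (ι → ℚ) ≃ (Fin n → ℚ)), (∀ i, 0 < w i) ∧
      ∀ x, x ⬝ᵥ T *ᵥ x = ∑ i, w i * f x i ^ 2 := by
  classical
  have hval : ∀ x, T.toQuadraticForm' x = x ⬝ᵥ T *ᵥ x := fun x => by
    simp [Matrix.toQuadraticForm', Matrix.toLinearMap₂'_apply']
  have : Invertible (2 : ℚ) := invertibleOfNonzero two_ne_zero
  have h := QuadraticForm.equivalent_weightedSumSquares T.toQuadraticForm'
  rw [Module.finrank_fintype_fun_eq_card, hn] at h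
  obtain ⟨w, ⟨f⟩⟩ := h
  have hf : ∀ x, x ⬝ᵥ T *ᵥ x = ∑ i, w i * f x i ^ 2 := fun x => by
    rw [← hval, ← f.map_app, QuadraticMap.weightedSumSquares_apply]
    simp [pow_two]
  refine ⟨w, f.toLinearEquiv.toEquiv, fun i => ?_, hf⟩
  have h0 : f.toLinearEquiv.symm (Pi.single i 1) ≠ 0 := by simp
  have := hT _ h0
  rw [hf] at this
  have h1 : f (f.toLinearEquiv.symm (Pi.single i 1)) = Pi.single i 1 :=
    f.toLinearEquiv.apply_symm_apply _
  rw [h1] at this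
  simpa [Pi.single_apply] using this

/-- At an integral vector the value is a rational combination of the entries, so φ passes through
it. Equal values of two real forms therefore give equal values of their rational images. -/
theorem map_qf_intCast {ι : Type*} [Fintype ι] (φ : ℝ →ₗ[ℚ] ℚ) (S : Matrix ι ι ℝ) (v : ι → ℤ) :
    φ ((fun i => (v i : ℝ)) ⬝ᵥ S *ᵥ fun i => (v i : ℝ)) =
      (fun i => (v i : ℚ)) ⬝ᵥ S.map φ *ᵥ fun i => (v i : ℚ) := by
  simp only [dotProduct_mulVec_eq_sum, map_sum, Matrix.map_apply]
  refine Finset.sum_congr rfl fun i _ => Finset.sum_congr rfl fun j _ => ?_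
  rw [← smul_eq_mul (_ * _ : ℚ), ← map_smul, Rat.smul_def]
  push_cast
  rfl

theorem qf_rat_pos {ι : Type*} [Fintype ι] (T : Matrix ι ι ℚ)
    (hT : (T.map (Rat.cast : ℚ → ℝ)).PosDef) (x : ι → ℚ) (hx : x ≠ 0) : 0 < x ⬝ᵥ T *ᵥ x := by
  have h0 : (fun i => (x i : ℝ)) ≠ 0 := by
    intro h; apply hx; funext i; simpa using congrFun h i
  have := hT.qf_pos h0
  rw [dotProduct_mulVec_eq_sum] at this ⊢
  simp only [Matrix.map_apply] at this
  exact_mod_cast this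

/-- A positive definite quaternary form represents a number that a given positive definite ternary
form does not represent. -/
theorem exists_int_value_not_ternary {ι κ : Type*} [Fintype ι] [Fintype κ]
    (hι : Fintype.card ι = 4) (hκ : Fintype.card κ = 3) (S : Matrix ι ι ℝ) (S₂ : Matrix κ κ ℝ)
    (hS : S.PosDef) (hS₂ : S₂.PosDef) : ∃ v : ι → ℤ, v ≠ 0 ∧ ∀ u : κ → ℤ,
      (fun i => (v i : ℝ)) ⬝ᵥ S *ᵥ (fun i => (v i : ℝ)) ≠
        (fun i => (u i : ℝ)) ⬝ᵥ S₂ *ᵥ (fun i => (u i : ℝ)) := by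
  obtain ⟨ε, hε, h⟩ := hS.exists_near
  obtain ⟨ε₂, hε₂, h₂⟩ := hS₂.exists_near
  obtain ⟨φ, hφ⟩ := exists_rat_linearMap_near
    (Set.range (fun p : ι × ι => S p.1 p.2) ∪ Set.range (fun p : κ × κ => S₂ p.1 p.2))
    ((Set.finite_range _).union (Set.finite_range _)) (min ε ε₂) (lt_min hε hε₂)
  have hT : ((S.map φ).map (Rat.cast : ℚ → ℝ)).PosDef := by
    refine h _ ?_ fun i j => (hφ _ (Or.inl ⟨(i, j), rfl⟩)).trans_le (min_le_left _ _)
    rw [← Matrix.transpose_map, ← Matrix.transpose_map, hS.transpose_eq]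
  have hT₂ : ((S₂.map φ).map (Rat.cast : ℚ → ℝ)).PosDef := by
    refine h₂ _ ?_ fun i j => (hφ _ (Or.inr ⟨(i, j), rfl⟩)).trans_le (min_le_right _ _)
    rw [← Matrix.transpose_map, ← Matrix.transpose_map, hS₂.transpose_eq]
  obtain ⟨w, f, hw, hf⟩ := exists_diagonal_rat hι _ (qf_rat_pos _ hT)
  obtain ⟨a, g, ha, hg⟩ := exists_diagonal_rat hκ _ (qf_rat_pos _ hT₂)
  obtain ⟨x, hx⟩ := exists_value_not_ternary w hw a ha
  have hne : ∀ y : κ → ℚ, f.symm x ⬝ᵥ S.map φ *ᵥ f.symm x ≠ y ⬝ᵥ S₂.map φ *ᵥ y := fun y => by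
    rw [hf, hg, f.apply_symm_apply]
    exact hx _
  -- A common denominator d makes the vector integral. Being missed over all of `ℚ` is insensitive
  -- to the resulting factor d².
  obtain ⟨d, hd⟩ := IsLocalization.exist_integer_multiples_of_finset (nonZeroDivisors ℤ)
    (Finset.univ.image (f.symm x))
  choose v hv using fun i => hd (f.symm x i) (Finset.mem_image_of_mem _ (Finset.mem_univ i))
  have hd0 : ((d : ℤ) : ℚ) ≠ 0 := by exact_mod_cast nonZeroDivisors.coe_ne_zero d
  have hv' : (fun i => (v i : ℚ)) = ((d : ℤ) : ℚ) • f.symm x := by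
    funext i
    simpa using hv i
  refine ⟨v, ?_, fun u hu => ?_⟩
  · rintro rfl
    apply hne 0
    have : f.symm x = 0 := by
      have h3 : ((d : ℤ) : ℚ) • f.symm x = 0 := by rw [← hv']; funext i; simp
      exact (smul_eq_zero.1 h3).resolve_left hd0
    simp [this]
  · have h3 := congrArg φ hu
    rw [map_qf_intCast, map_qf_intCast, hv'] at h3
    apply hne (((d : ℤ) : ℚ)⁻¹ • fun i => (u i : ℚ))
    simp only [Matrix.mulVec_smul, dotProduct_smul, smul_dotProduct, smul_eq_mul] at h3 ⊢
    rw [← h3]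
    field_simp

theorem qf_fromBlocks {ι κ : Type*} [Fintype ι] [Fintype κ] [DecidableEq κ] (S : Matrix ι ι ℝ)
    (x : ι → ℝ) (y : κ → ℝ) :
    Sum.elim x y ⬝ᵥ Matrix.fromBlocks S 0 0 (1 : Matrix κ κ ℝ) *ᵥ Sum.elim x y =
      x ⬝ᵥ S *ᵥ x + y ⬝ᵥ y := by
  rw [Matrix.fromBlocks_mulVec]
  simp [dotProduct]

theorem posDef_fromBlocks_one {ι κ : Type*} [Fintype ι] [Fintype κ] [DecidableEq κ]
    {S : Matrix ι ι ℝ} (hS : S.PosDef) :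
    (Matrix.fromBlocks S 0 0 (1 : Matrix κ κ ℝ)).PosDef := by
  refine posDef_of_qf_pos ?_ fun v hv => ?_
  · rw [Matrix.fromBlocks_transpose, hS.transpose_eq]; simp
  · obtain ⟨x, y, rfl⟩ : ∃ x y, v = Sum.elim x y := ⟨_, _, (Sum.elim_comp_inl_inr v).symm⟩
    rw [qf_fromBlocks]
    have hy : 0 ≤ y ⬝ᵥ y := by
      simp only [dotProduct]; exact Finset.sum_nonneg fun i _ => mul_self_nonneg _
    by_cases hx : x = 0
    · subst hx
      have hy0 : y ≠ 0 := by
        rintro rfl; apply hv; ext i; cases i <;> simp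
      have : y ⬝ᵥ y ≠ 0 := by rwa [Ne, dotProduct_self_eq_zero]
      have := lt_of_le_of_ne hy this.symm
      simpa using this
    · have := hS.qf_pos hx
      linarith

/-- A positive definite form of rank at most `4` represents a number that a given positive definite
form of smaller positive rank does not represent. -/
theorem not_rep_subset {N N₂ : ℕ} (hlt : N₂ < N) (hN : N ≤ 4)
    (S : Matrix (Fin N) (Fin N) ℝ) (S₂ : Matrix (Fin N₂) (Fin N₂) ℝ) (hS : S.PosDef)
    (hS₂ : S₂.PosDef) : ¬ Rep S ⊆ Rep S₂ := by
  intro hsub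
  -- The common unit block of rank 4 - N keeps the inclusion of values; the extra N - N₂ - 1
  -- coordinates only raise the second rank to 3 and are set to 0.
  obtain ⟨v, hv, h⟩ := exists_int_value_not_ternary
    (ι := Fin N ⊕ Fin (4 - N)) (κ := Fin N₂ ⊕ (Fin (4 - N) ⊕ Fin (N - N₂ - 1)))
    (by simp; omega) (by simp; omega) _ _ (posDef_fromBlocks_one hS) (posDef_fromBlocks_one hS₂)
  have hcast : ∀ {α β : Type} (x : α → ℤ) (y : β → ℤ), (fun i => ((Sum.elim x y i : ℤ) : ℝ)) =
      Sum.elim (fun i => (x i : ℝ)) (fun i => (y i : ℝ)) := by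
    intro α β x y; ext i; cases i <;> rfl
  obtain ⟨x, y, rfl⟩ : ∃ x y, v = Sum.elim x y := ⟨_, _, (Sum.elim_comp_inl_inr v).symm⟩
  obtain ⟨u, hu⟩ : ∃ u : Fin N₂ → ℤ, (fun i => (x i : ℝ)) ⬝ᵥ S *ᵥ (fun i => (x i : ℝ)) =
      (fun i => (u i : ℝ)) ⬝ᵥ S₂ *ᵥ (fun i => (u i : ℝ)) := by
    by_cases hx : x = 0
    · refine ⟨0, ?_⟩
      subst hx
      simp [dotProduct]
    · obtain ⟨u, -, hu⟩ := hsub ⟨x, hx, rfl⟩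
      exact ⟨u, hu⟩
  apply h (Sum.elim u (Sum.elim y 0))
  rw [hcast, hcast, hcast, qf_fromBlocks, qf_fromBlocks, hu]
  simp [dotProduct]

/-! ### Values at integral vectors and rounding -/

/-- The value `ᵗv S v` of the form `S` at an integral vector `v`. -/
def intForm {N : ℕ} (S : Matrix (Fin N) (Fin N) ℝ) (v : Fin N → ℤ) : ℝ :=
  (fun i => (v i : ℝ)) ⬝ᵥ (S *ᵥ fun i => (v i : ℝ))

section Form
variable {N : ℕ} {S : Matrix (Fin N) (Fin N) ℝ}

theorem intForm_pos (hS : S.PosDef) {v : Fin N → ℤ} (hv : v ≠ 0) : 0 < intForm S v := by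
  refine hS.qf_pos fun h => hv ?_
  funext i
  simpa using congrFun h i

theorem finite_intForm_le (hS : S.PosDef) (X : ℝ) : {v : Fin N → ℤ | intForm S v ≤ X}.Finite := by
  obtain ⟨c, hc, h⟩ := hS.exists_coercive
  obtain ⟨B, hB⟩ := exists_nat_gt (X / c + 1)
  refine (Set.finite_Icc (fun _ => -(B : ℤ)) (fun _ : Fin N => (B : ℤ))).subset fun v hv => ?_
  have hv : intForm S v ≤ X := hv
  have habs : ∀ i, |v i| ≤ (B : ℤ) := by
    intro i
    have h1 : |(v i : ℝ)| ≤ ‖fun i => (v i : ℝ)‖ := norm_le_pi_norm (fun i => (v i : ℝ)) i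
    have h2 : ‖fun i => (v i : ℝ)‖ ^ 2 ≤ X / c := by
      rw [le_div_iff₀ hc, mul_comm]
      exact (h _).trans hv
    have h3 : |(v i : ℝ)| ≤ B := by nlinarith [abs_nonneg (v i : ℝ)]
    exact_mod_cast h3
  exact ⟨fun i => (abs_le.1 (habs i)).1, fun i => (abs_le.1 (habs i)).2⟩

theorem exists_min_intForm (hS : S.PosDef) {A : Set (Fin N → ℤ)} (hA : A.Nonempty) :
    ∃ v ∈ A, ∀ w ∈ A, intForm S v ≤ intForm S w := by
  obtain ⟨v₀, hv₀⟩ := hA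
  obtain ⟨v, ⟨hvA, hv⟩, hmin⟩ := Set.exists_min_image {v | v ∈ A ∧ intForm S v ≤ intForm S v₀}
    (intForm S) ((finite_intForm_le hS (intForm S v₀)).subset fun v hv => hv.2) ⟨v₀, hv₀, le_rfl⟩
  refine ⟨v, hvA, fun w hw => ?_⟩
  rcases le_total (intForm S w) (intForm S v₀) with h | h
  · exact hmin w ⟨hw, h⟩
  · exact hv.trans h

theorem intForm_neg (v : Fin N → ℤ) : intForm S (-v) = intForm S v := by
  have : (fun i => (((-v) i : ℤ) : ℝ)) = -fun i => (v i : ℝ) := by funext i; simp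
  rw [intForm, this, Matrix.mulVec_neg, neg_dotProduct_neg, intForm]

theorem intForm_single (i : Fin N) : intForm S (Pi.single i 1) = S i i := by
  have : (fun j => ((Pi.single i (1 : ℤ) : Fin N → ℤ) j : ℝ)) = Pi.single i 1 := by
    funext j
    by_cases h : j = i
    · subst h; simp
    · simp [h]
  simp [intForm, this]

end Form

/-- Rounding the coefficients of a linear combination costs at most a quarter of the sum of the
values of the form at the vectors. -/
theorem exists_rounding {ι κ : Type*} [Fintype ι] [DecidableEq κ] (S : Matrix ι ι ℝ)
    (v : κ → ι → ℝ) (hv : ∀ k, 0 ≤ v k ⬝ᵥ S *ᵥ v k) (c : κ → ℝ) (y : ι → ℝ) (s : Finset κ) :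
    ∃ a : κ → ℤ, (y + ∑ k ∈ s, (c k - a k) • v k) ⬝ᵥ S *ᵥ (y + ∑ k ∈ s, (c k - a k) • v k) ≤
      y ⬝ᵥ S *ᵥ y + 1 / 4 * ∑ k ∈ s, v k ⬝ᵥ S *ᵥ v k := by
  induction s using Finset.induction_on with
  | empty => exact ⟨0, by simp⟩
  | insert k s hk ih =>
    obtain ⟨a, ha⟩ := ih
    have hsum : ∀ m : ℤ, y + ∑ j ∈ insert k s, (c j - (Function.update a k m j : ℤ)) • v j =
        (y + ∑ j ∈ s, (c j - a j) • v j) + (c k - m) • v k := by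
      intro m
      rw [Finset.sum_insert hk, Function.update_self, add_comm (_ • v k), ← add_assoc]
      congr 2
      refine Finset.sum_congr rfl fun j hj => ?_
      rw [Function.update_of_ne (by rintro rfl; exact hk hj)]
    set z := y + ∑ j ∈ s, (c j - a j) • v j
    have hq : ∀ r : ℝ, (z + r • v k) ⬝ᵥ S *ᵥ (z + r • v k) = z ⬝ᵥ S *ᵥ z +
        r * (z ⬝ᵥ S *ᵥ v k + v k ⬝ᵥ S *ᵥ z) + r ^ 2 * (v k ⬝ᵥ S *ᵥ v k) := by
      intro r
      simp only [Matrix.mulVec_add, Matrix.mulVec_smul, dotProduct_add, add_dotProduct,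
        dotProduct_smul, smul_dotProduct, smul_eq_mul]
      ring
    rw [Finset.sum_insert hk]
    set t := Int.fract (c k) with ht
    have ht0 : 0 ≤ t := Int.fract_nonneg _
    have ht1 : t < 1 := Int.fract_lt_one _
    have hkv := hv k
    by_contra hcon
    push Not at hcon
    have h1 := hcon (Function.update a k ⌊c k⌋)
    have h2 := hcon (Function.update a k (⌊c k⌋ + 1))
    rw [hsum, hq] at h1 h2
    have e1 : c k - ⌊c k⌋ = t := rfl
    have e2 : c k - ((⌊c k⌋ + 1 : ℤ) : ℝ) = t - 1 := by push_cast; rw [← e1]; ring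
    rw [e1] at h1
    rw [e2] at h2
    set B := z ⬝ᵥ S *ᵥ v k + v k ⬝ᵥ S *ᵥ z
    set q := v k ⬝ᵥ S *ᵥ v k
    have h3 : t * (1 - t) * q ≤ 1 / 4 * q := by
      apply mul_le_mul_of_nonneg_right _ hkv
      nlinarith [sq_nonneg (t - 1 / 2)]
    -- Weighting rounding down by 1 - t and rounding up by t cancels the cross term and leaves t(1 -
    -- t)q ≤ q/4, so both choices cannot exceed the bound.
    nlinarith [mul_lt_mul_of_pos_left h1 (by linarith : 0 < 1 - t),
      mul_le_mul_of_nonneg_left h2.le ht0]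

/-! ### Successive minima and reduction in rank at most four -/

section Lattice
variable {N : ℕ}

/-- The vectors that some functional vanishing on `L` maps to `1`. -/
def primitiveModulo (L : Submodule ℤ (Fin N → ℤ)) : Set (Fin N → ℤ) :=
  {u | ∃ f : (Fin N → ℤ) →ₗ[ℤ] ℤ, (∀ l ∈ L, f l = 0) ∧ f u = 1}

theorem neg_mem_primitiveModulo {L : Submodule ℤ (Fin N → ℤ)} {u : Fin N → ℤ}
    (hu : u ∈ primitiveModulo L) : -u ∈ primitiveModulo L := by
  obtain ⟨f, hf, h⟩ := hu
  exact ⟨-f, fun l hl => by simp [hf l hl], by simp [h]⟩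

/-- Every vector outside a saturated sublattice is, modulo the sublattice, a positive multiple of a
primitive vector. -/
theorem exists_primitiveModulo (L : Submodule ℤ (Fin N → ℤ))
    (hL : ∀ (k : ℤ) (w : Fin N → ℤ), k ≠ 0 → k • w ∈ L → w ∈ L) (w : Fin N → ℤ) (hw : w ∉ L) :
    ∃ (k : ℤ) (u : Fin N → ℤ), 0 < k ∧ u ∈ primitiveModulo L ∧ w - k • u ∈ L := by
  have : Module.IsTorsionFree ℤ ((Fin N → ℤ) ⧸ L) := by
    refine Module.isTorsionFree_iff_smul_eq_zero.2 ?_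
    intro k m h
    obtain ⟨x, rfl⟩ := L.mkQ_surjective m
    by_cases hk : k = 0
    · exact Or.inl hk
    · right
      rw [← map_smul, Submodule.mkQ_apply, Submodule.Quotient.mk_eq_zero] at h
      rw [Submodule.mkQ_apply, Submodule.Quotient.mk_eq_zero]
      exact hL k x hk h
  let b := Module.Free.chooseBasis ℤ ((Fin N → ℤ) ⧸ L)
  set m := L.mkQ w with hm
  have hm0 : m ≠ 0 := by
    rw [hm, Ne, Submodule.mkQ_apply, Submodule.Quotient.mk_eq_zero]
    exact hw
  -- The values of all functionals at m form an ideal. Its generator d is the content of m, and m/d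
  -- is primitive.
  obtain ⟨d, hd⟩ := (IsPrincipalIdealRing.principal
    (LinearMap.range (Module.Dual.eval ℤ ((Fin N → ℤ) ⧸ L) m))).principal
  have hdiv : ∀ g : Module.Dual ℤ ((Fin N → ℤ) ⧸ L), d ∣ g m := by
    intro g
    rw [← Ideal.mem_span_singleton, Ideal.span, ← hd]
    exact ⟨g, rfl⟩
  obtain ⟨g, hg⟩ : ∃ g : Module.Dual ℤ ((Fin N → ℤ) ⧸ L), g m = d := by
    have : d ∈ LinearMap.range (Module.Dual.eval ℤ ((Fin N → ℤ) ⧸ L) m) := by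
      rw [hd]; exact Submodule.mem_span_singleton_self d
    exact this
  have hd0 : d ≠ 0 := by
    rintro rfl
    apply hm0
    apply b.ext_elem
    intro i
    have := zero_dvd_iff.1 (hdiv (b.coord i))
    simpa using this
  choose e he using fun i => hdiv (b.coord i)
  obtain ⟨u, hu⟩ := L.mkQ_surjective (∑ i, e i • b i)
  have hmu : m = d • L.mkQ u := by
    rw [hu, Finset.smul_sum, ← b.sum_repr m]
    refine Finset.sum_congr rfl fun i _ => ?_
    rw [smul_smul, ← he i]
    rfl
  have hgu : g (L.mkQ u) = 1 := by
    have h1 := congrArg g hmu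
    rw [hg, map_smul, smul_eq_mul] at h1
    exact mul_left_cancel₀ hd0 (by rw [← h1, mul_one])
  have hprim : u ∈ primitiveModulo L := by
    refine ⟨g ∘ₗ L.mkQ, fun l hl => ?_, hgu⟩
    rw [LinearMap.comp_apply, Submodule.mkQ_apply, (Submodule.Quotient.mk_eq_zero L).2 hl, map_zero]
  have hmem : w - d • u ∈ L := by
    rw [← Submodule.Quotient.mk_eq_zero, ← Submodule.mkQ_apply, map_sub, map_smul, ← hmu, sub_self]
  rcases lt_or_gt_of_ne hd0 with h | h
  · exact ⟨-d, -u, by omega, neg_mem_primitiveModulo hprim, by simpa using hmem⟩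
  · exact ⟨d, u, h, hprim, hmem⟩

/-- The lattice spanned by the first `n` vectors of a sequence. -/
def initialSpan (v : ℕ → Fin N → ℤ) (n : ℕ) : Submodule ℤ (Fin N → ℤ) :=
  Submodule.span ℤ (v '' (Finset.range n : Set ℕ))

theorem initialSpan_mono (v : ℕ → Fin N → ℤ) {m n : ℕ} (h : m ≤ n) :
    initialSpan v m ≤ initialSpan v n :=
  Submodule.span_mono (Set.image_mono (by simpa using h))

theorem mem_initialSpan {v : ℕ → Fin N → ℤ} {n : ℕ} {w : Fin N → ℤ} :
    w ∈ initialSpan v n ↔ ∃ c : ℕ → ℤ, ∑ i ∈ Finset.range n, c i • v i = w := by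
  rw [initialSpan, Submodule.mem_span_image_finset_iff_exists_fun]
  constructor
  · rintro ⟨c, rfl⟩
    refine ⟨fun i => if h : i ∈ Finset.range n then c ⟨i, h⟩ else 0, ?_⟩
    rw [← Finset.sum_coe_sort]
    exact Finset.sum_congr rfl fun i _ => by simp only [dif_pos i.2]
  · rintro ⟨c, rfl⟩
    exact ⟨fun i => c i, Finset.sum_coe_sort (Finset.range n) fun i => c i • v i⟩

theorem initialSpan_update_of_le (v : ℕ → Fin N → ℤ) {m n : ℕ} (h : m ≤ n) (x : Fin N → ℤ) :
    initialSpan (Function.update v n x) m = initialSpan v m := by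
  unfold initialSpan
  congr 1
  refine Set.image_congr fun i hi => ?_
  rw [Function.update_of_ne]
  simp at hi
  omega

theorem mem_initialSpan_succ {v : ℕ → Fin N → ℤ} {n : ℕ} {w : Fin N → ℤ} :
    w ∈ initialSpan v (n + 1) ↔ ∃ k : ℤ, w - k • v n ∈ initialSpan v n := by
  constructor
  · intro h
    obtain ⟨c, rfl⟩ := mem_initialSpan.1 h
    exact ⟨c n, mem_initialSpan.2 ⟨c, by rw [Finset.sum_range_succ]; abel⟩⟩
  · rintro ⟨k, h⟩
    have h1 := initialSpan_mono v (Nat.le_succ n) h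
    have h2 : v n ∈ initialSpan v (n + 1) := Submodule.subset_span ⟨n, by simp, rfl⟩
    simpa using add_mem h1 (Submodule.smul_mem _ k h2)

/-- The first `n` vectors of `v` are successive minima of `S`, are linearly independent and span a
saturated sublattice, and consecutive vectors make obtuse angles. -/
structure MinimalFlag (S : Matrix (Fin N) (Fin N) ℝ) (n : ℕ) (v : ℕ → Fin N → ℤ) : Prop where
  indep : LinearIndependent ℤ fun i : Fin n => v i
  saturated : ∀ (k : ℤ) (w : Fin N → ℤ), k ≠ 0 → k • w ∈ initialSpan v n → w ∈ initialSpan v n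
  minimal : ∀ i < n, ∀ w, w ∉ initialSpan v i → intForm S (v i) ≤ intForm S w
  obtuse : ∀ i, i + 1 < n →
    (fun j => (v i j : ℝ)) ⬝ᵥ S *ᵥ (fun j => (v (i + 1) j : ℝ)) ≤ 0

theorem linearIndependent_update {v : ℕ → Fin N → ℤ} {n : ℕ} {u : Fin N → ℤ}
    (h : LinearIndependent ℤ fun i : Fin n => v i) (hu : u ∈ primitiveModulo (initialSpan v n)) :
    LinearIndependent ℤ fun i : Fin (n + 1) => Function.update v n u i := by
  obtain ⟨f, hf, hfu⟩ := hu
  rw [Fintype.linearIndependent_iff] at h ⊢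
  intro g hg
  have hupd : ∀ i : Fin n, Function.update v n u (i.castSucc : Fin (n + 1)) = v i := fun i => by
    rw [Function.update_of_ne (by simpa using i.2.ne), Fin.val_castSucc]
  rw [Fin.sum_univ_castSucc] at hg
  simp only [hupd, Fin.val_last, Function.update_self] at hg
  have hlast : g (Fin.last n) = 0 := by
    have := congrArg f hg
    have hmem : ∑ i : Fin n, g i.castSucc • v i ∈ initialSpan v n := Submodule.sum_mem _ fun i _ =>
      Submodule.smul_mem _ _ (Submodule.subset_span ⟨i, by simp, rfl⟩)
    rw [map_add, map_smul, hfu, map_zero, hf _ hmem] at this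
    simpa using this
  rw [hlast, zero_smul, add_zero] at hg
  intro i
  exact Fin.lastCases hlast (fun j => h _ hg j) i

end Lattice

section Lattice
variable {N : ℕ}

/-- The functional f reads off the coefficient of u, so w - f(w) u is the only candidate for the
part in the old lattice, and the saturation of that lattice applies to its multiple by k. -/
theorem saturated_update {v : ℕ → Fin N → ℤ} {n : ℕ} {u : Fin N → ℤ}
    (h : ∀ (k : ℤ) (w : Fin N → ℤ), k ≠ 0 → k • w ∈ initialSpan v n → w ∈ initialSpan v n)
    (hu : u ∈ primitiveModulo (initialSpan v n)) (k : ℤ) (w : Fin N → ℤ) (hk : k ≠ 0)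
    (hw : k • w ∈ initialSpan (Function.update v n u) (n + 1)) :
    w ∈ initialSpan (Function.update v n u) (n + 1) := by
  obtain ⟨f, hf, hfu⟩ := hu
  rw [mem_initialSpan_succ, initialSpan_update_of_le v le_rfl, Function.update_self] at hw ⊢
  obtain ⟨m, hm⟩ := hw
  refine ⟨f w, h k _ hk ?_⟩
  have h0 := hf _ hm
  rw [map_sub, map_smul, map_smul, hfu, smul_eq_mul, smul_eq_mul, mul_one, sub_eq_zero] at h0
  rwa [smul_sub, smul_smul, h0]

/-- A shortest primitive vector modulo the span of the first `n ≤ 3` successive minima is a shortest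
vector outside that span. -/
theorem intForm_le_of_primitive_minimal {S : Matrix (Fin N) (Fin N) ℝ} (hS : S.PosDef) {n : ℕ}
    (hn : n < 4) {v : ℕ → Fin N → ℤ} (hv : MinimalFlag S n v) {x : Fin N → ℤ}
    (hmin : ∀ u ∈ primitiveModulo (initialSpan v n), intForm S x ≤ intForm S u)
    (w : Fin N → ℤ) (hw : w ∉ initialSpan v n) : intForm S x ≤ intForm S w := by
  obtain ⟨k, u, hk, ⟨f, hf, hfu⟩, hmem⟩ := exists_primitiveModulo _ hv.saturated w hw
  rcases eq_or_lt_of_le (Int.add_one_le_of_lt hk) with h1 | h2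
  · refine hmin w ⟨f, hf, ?_⟩
    have := hf _ hmem
    rw [map_sub, map_smul, hfu, ← h1, sub_eq_zero] at this
    simpa using this
  have hk2 : (2 : ℝ) ≤ k := by exact_mod_cast h2
  have hk0 : (k : ℝ) ≠ 0 := by positivity
  obtain ⟨c, hc⟩ := mem_initialSpan.1 hmem
  -- For w = k u + l with k ≥ 2, translating u by the lattice to lie near w/k costs at most q(w)/4 +
  -- n q(w)/4, which is at most q(w) as n ≤ 3. This is where the rank bound 4 enters the reduction.
  obtain ⟨a, ha⟩ := exists_rounding S (fun (i : ℕ) j => (v i j : ℝ))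
    (fun i => hS.posSemidef.dotProduct_mulVec_nonneg _) (fun i => -(c i : ℝ) / k)
    ((k : ℝ)⁻¹ • fun j => (w j : ℝ)) (Finset.range n)
  have hu' : u - ∑ i ∈ Finset.range n, a i • v i ∈ primitiveModulo (initialSpan v n) := by
    refine ⟨f, hf, ?_⟩
    rw [map_sub, hfu, hf _ (mem_initialSpan.2 ⟨a, rfl⟩), sub_zero]
  have hcast : ((k : ℝ)⁻¹ • fun j => (w j : ℝ)) +
      ∑ i ∈ Finset.range n, (-(c i : ℝ) / k - a i) • (fun j => (v i j : ℝ)) =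
      fun j => (((u - ∑ i ∈ Finset.range n, a i • v i) j : ℤ) : ℝ) := by
    funext j
    have hj := congrArg (Int.cast (R := ℝ)) (congrFun hc j)
    simp only [Finset.sum_apply, Pi.smul_apply, Pi.sub_apply, smul_eq_mul, Int.cast_sum,
      Int.cast_mul, Int.cast_sub, Pi.add_apply] at hj ⊢
    simp only [sub_mul, Finset.sum_sub_distrib, neg_div, neg_mul, Finset.sum_neg_distrib,
      div_mul_eq_mul_div, ← Finset.sum_div]
    rw [hj]
    field_simp
    ring
  rw [hcast, Matrix.mulVec_smul, dotProduct_smul, smul_dotProduct, smul_eq_mul, smul_eq_mul] at ha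
  have hle := (hmin _ hu').trans ha
  have hsum : ∑ i ∈ Finset.range n, intForm S (v i) ≤ n * intForm S w := by
    refine (Finset.sum_le_card_nsmul _ _ (intForm S w) fun i hi => ?_).trans (by simp)
    rw [Finset.mem_range] at hi
    exact hv.minimal i hi w fun h => hw (initialSpan_mono v hi.le h)
  have hw0 : 0 < intForm S w := by
    apply intForm_pos hS
    rintro rfl
    exact hw (zero_mem _)
  change intForm S x ≤ (k : ℝ)⁻¹ * ((k : ℝ)⁻¹ * intForm S w) +
    1 / 4 * ∑ i ∈ Finset.range n, intForm S (v i) at hle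
  have hn3 : (n : ℝ) ≤ 3 := by exact_mod_cast Nat.lt_succ_iff.1 hn
  have hki : (k : ℝ)⁻¹ * (k : ℝ)⁻¹ ≤ 1 / 4 := by
    have h1 : (k : ℝ)⁻¹ ≤ 2⁻¹ := inv_anti₀ two_pos hk2
    have h0 : 0 ≤ (k : ℝ)⁻¹ := by positivity
    nlinarith
  nlinarith

theorem MinimalFlag.exists_succ {S : Matrix (Fin N) (Fin N) ℝ} (hS : S.PosDef) {n : ℕ}
    (hn : n < 4) {v : ℕ → Fin N → ℤ} (hv : MinimalFlag S n v) (hne : ∃ w, w ∉ initialSpan v n) :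
    ∃ v', MinimalFlag S (n + 1) v' := by
  obtain ⟨w, hw⟩ := hne
  obtain ⟨k, u, hk, hu, -⟩ := exists_primitiveModulo _ hv.saturated w hw
  obtain ⟨x₀, hx₀, hmin₀⟩ := exists_min_intForm hS ⟨u, hu⟩
  -- The sign of the new vector is free and is chosen to make the angle with its predecessor obtuse.
  -- For n = 0 the index n - 1 is 0 and the condition is harmless, since there is no predecessor.
  obtain ⟨x, hx, hmin, hobt⟩ : ∃ x ∈ primitiveModulo (initialSpan v n),
      (∀ u ∈ primitiveModulo (initialSpan v n), intForm S x ≤ intForm S u) ∧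
      (fun j => (v (n - 1) j : ℝ)) ⬝ᵥ S *ᵥ (fun j => (x j : ℝ)) ≤ 0 := by
    rcases le_total ((fun j => (v (n - 1) j : ℝ)) ⬝ᵥ S *ᵥ (fun j => (x₀ j : ℝ))) 0 with h | h
    · exact ⟨x₀, hx₀, hmin₀, h⟩
    · refine ⟨-x₀, neg_mem_primitiveModulo hx₀, fun u hu => ?_, ?_⟩
      · rw [intForm_neg]; exact hmin₀ u hu
      · have : (fun j => (((-x₀) j : ℤ) : ℝ)) = -fun j => (x₀ j : ℝ) := by funext j; simp
        rw [this, Matrix.mulVec_neg, dotProduct_neg]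
        linarith
  refine ⟨Function.update v n x, linearIndependent_update hv.indep hx,
    saturated_update hv.saturated hx, fun i hi z hz => ?_, fun i hi => ?_⟩
  · rw [initialSpan_update_of_le v (Nat.lt_succ_iff.1 hi)] at hz
    rcases Nat.lt_succ_iff_lt_or_eq.1 hi with h | rfl
    · rw [Function.update_of_ne h.ne]
      exact hv.minimal i h z hz
    · rw [Function.update_self]
      exact intForm_le_of_primitive_minimal hS hn hv hmin z hz
  · rw [Function.update_of_ne (by omega)]
    rcases Nat.lt_succ_iff_lt_or_eq.1 hi with h | rfl
    · rw [Function.update_of_ne h.ne]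
      exact hv.obtuse i h
    · rw [Function.update_self]
      exact hobt

theorem exists_minimalFlag {S : Matrix (Fin N) (Fin N) ℝ} (hS : S.PosDef) (hN : N ≤ 4) (n : ℕ)
    (hn : n ≤ N) : ∃ v, MinimalFlag S n v := by
  induction n with
  | zero =>
    refine ⟨0, linearIndependent_empty_type, fun k w hk h => ?_, fun i hi => absurd hi (by omega),
      fun i hi => absurd hi (by omega)⟩
    have h0 : k • w = 0 := by simpa [initialSpan, -zsmul_eq_mul] using h
    simp [(smul_eq_zero.1 h0).resolve_left hk]
  | succ n ih =>
    obtain ⟨v, hv⟩ := ih (by omega)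
    refine hv.exists_succ hS (by omega) ?_
    by_contra hcon
    push Not at hcon
    have htop : Submodule.span ℤ (Set.range fun i : Fin n => v i) = ⊤ := by
      rw [eq_top_iff]
      intro w _
      refine Submodule.span_mono ?_ (hcon w)
      rintro _ ⟨i, hi, rfl⟩
      exact ⟨⟨i, by simpa using hi⟩, rfl⟩
    have := finrank_range_le_card (R := ℤ) (fun i : Fin n => v i)
    rw [Set.finrank, htop, finrank_top, Module.finrank_fin_fun, Fintype.card_fin] at this
    omega

/-- A vector outside the saturated span would yield N + 1 independent vectors in rank N. -/
theorem MinimalFlag.initialSpan_eq_top {S : Matrix (Fin N) (Fin N) ℝ} {v : ℕ → Fin N → ℤ}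
    (hv : MinimalFlag S N v) : initialSpan v N = ⊤ := by
  rw [eq_top_iff]
  intro w _
  by_contra hw
  obtain ⟨k, u, hk, hu, -⟩ := exists_primitiveModulo _ hv.saturated w hw
  have := (linearIndependent_update hv.indep hu).fintype_card_le_finrank
  rw [Module.finrank_fin_fun, Fintype.card_fin] at this
  omega

/-- Each diagonal entry is the least value of the form at integral vectors not supported on the
previous coordinates, and the entries next to the diagonal are not positive. -/
structure Reduced (S : Matrix (Fin N) (Fin N) ℝ) : Prop where
  minimal : ∀ (i : Fin N) (x : Fin N → ℤ), (∃ j, i ≤ j ∧ x j ≠ 0) → S i i ≤ intForm S x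
  obtuse : ∀ i j : Fin N, (i : ℕ) + 1 = j → S i j ≤ 0

theorem Equivalent.posDef {S T : Matrix (Fin N) (Fin N) ℝ} (h : Equivalent S T) (hS : S.PosDef) :
    T.PosDef := by
  obtain ⟨g, rfl⟩ := h
  set G := (g : Matrix (Fin N) (Fin N) ℤ).map (Int.cast : ℤ → ℝ) with hG
  have hinv : G * ((g⁻¹ : GL (Fin N) ℤ) : Matrix (Fin N) (Fin N) ℤ).map (Int.cast : ℤ → ℝ) = 1 := by
    have h2 := congrArg (fun A : Matrix (Fin N) (Fin N) ℤ => A.map (Int.castRingHom ℝ))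
      (Units.mul_inv g)
    simp only [Matrix.map_mul] at h2
    simpa [Matrix.map_one] using h2
  have := hS.mul_mul_conjTranspose_same (B := G) (Matrix.vecMul_injective_of_isUnit
    (IsUnit.of_mul_eq_one _ hinv))
  simpa [Matrix.conjTranspose_eq_transpose_of_trivial] using this

theorem intForm_conj (S : Matrix (Fin N) (Fin N) ℝ) (g : Matrix (Fin N) (Fin N) ℤ)
    (x : Fin N → ℤ) :
    intForm (g.map (Int.cast : ℤ → ℝ) * S * (g.map (Int.cast : ℤ → ℝ))ᵀ) x =
      intForm S (x ᵥ* g) := by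
  have : (fun i => (((x ᵥ* g) i : ℤ) : ℝ)) =
      (fun i => (x i : ℝ)) ᵥ* g.map (Int.cast : ℤ → ℝ) := by
    funext j
    simp [Matrix.vecMul, dotProduct]
  rw [intForm, intForm, this, ← Matrix.mulVec_mulVec, ← Matrix.mulVec_mulVec,
    Matrix.mulVec_transpose, Matrix.dotProduct_mulVec]

theorem Equivalent.rep_subset {S T : Matrix (Fin N) (Fin N) ℝ} (h : Equivalent S T) :
    Rep T ⊆ Rep S := by
  obtain ⟨g, rfl⟩ := h
  rintro _ ⟨x, hx, rfl⟩
  refine ⟨x ᵥ* (g : Matrix (Fin N) (Fin N) ℤ), fun h0 => hx ?_, intForm_conj S _ x⟩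
  exact Matrix.vecMul_injective_of_isUnit g.isUnit (by simpa using h0)

theorem Equivalent.rep_eq {S T : Matrix (Fin N) (Fin N) ℝ} (h : Equivalent S T) :
    Rep T = Rep S :=
  h.rep_subset.antisymm h.symm.rep_subset

theorem exists_reduced {S : Matrix (Fin N) (Fin N) ℝ} (hS : S.PosDef) (hN : N ≤ 4) :
    ∃ T, Equivalent S T ∧ Reduced T := by
  obtain ⟨v, hv⟩ := exists_minimalFlag hS hN N le_rfl
  set G : Matrix (Fin N) (Fin N) ℤ := Matrix.of fun i j => v i j with hG
  have htop := hv.initialSpan_eq_top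
  have hrow : ∀ (x : ℕ → ℤ), ∑ i ∈ Finset.range N, x i • v i = (fun i : Fin N => x i) ᵥ* G := by
    intro x
    rw [← Fin.sum_univ_eq_sum_range (fun i => x i • v i)]
    funext j
    simp [hG, Matrix.vecMul, dotProduct]
  have hinv : ∃ C : Matrix (Fin N) (Fin N) ℤ, C * G = 1 := by
    have : ∀ i : Fin N, ∃ c : ℕ → ℤ, ∑ k ∈ Finset.range N, c k • v k = Pi.single i 1 := fun i =>
      mem_initialSpan.1 (by rw [htop]; trivial)
    choose c hc using this
    refine ⟨Matrix.of fun i k => c i k, ?_⟩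
    ext i j
    have := congrFun ((hrow (c i)).symm.trans (hc i)) j
    rw [Matrix.one_apply, Matrix.mul_apply]
    rw [Pi.single_apply] at this
    simpa [Matrix.vecMul, dotProduct, eq_comm] using this
  obtain ⟨C, hC⟩ := hinv
  have hGu : IsUnit G := IsUnit.of_mul_eq_one_right _ hC
  refine ⟨_, ⟨hGu.unit, rfl⟩, ?_, ?_⟩
  · rintro i x ⟨j, hij, hj⟩
    refine (intForm_single i).symm.trans_le ?_
    rw [intForm_conj, intForm_conj]
    have h1 : (Pi.single i 1 : Fin N → ℤ) ᵥ* G = v i := by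
      funext k
      simp [hG]
    rw [IsUnit.unit_spec, h1]
    refine hv.minimal i i.2 _ fun hmem => hj ?_
    obtain ⟨c, hc⟩ := mem_initialSpan.1 hmem
    -- Extending the coefficients by 0 lets invertibility of G compare them with x, which has a
    -- nonzero coordinate at some j ≥ i.
    set c' : ℕ → ℤ := fun k => if k < (i : ℕ) then c k else 0 with hc'
    have h2 : ∑ k ∈ Finset.range N, c' k • v k = ∑ k ∈ Finset.range i, c k • v k := by
      rw [← Finset.sum_subset (Finset.range_mono i.2.le) (fun k _ hk => by
        rw [hc']; simp at hk; simp [hk])]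
      exact Finset.sum_congr rfl fun k hk => by rw [hc']; simp [Finset.mem_range.1 hk]
    rw [← h2, hrow] at hc
    have := congrFun (Matrix.vecMul_injective_of_isUnit hGu hc) j
    rw [← this, hc']
    simp [hij]
  · intro i j hij
    have := hv.obtuse i (by omega)
    rw [hij] at this
    rw [IsUnit.unit_spec, Matrix.mul_assoc, Matrix.mul_apply_eq_vecMul]
    convert! this using 1

end Lattice

/-! ### Bounds for reduced matrices and finiteness of classes -/

section Finiteness
variable {N : ℕ}

theorem finite_rep_le {S : Matrix (Fin N) (Fin N) ℝ} (hS : S.PosDef) (X : ℝ) :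
    {x ∈ Rep S | x ≤ X}.Finite := by
  refine ((finite_intForm_le hS X).image (intForm S)).subset ?_
  rintro _ ⟨⟨v, hv, rfl⟩, hx⟩
  exact ⟨v, hx, rfl⟩

theorem intForm_single_add_single {S : Matrix (Fin N) (Fin N) ℝ} (hS : S.PosDef) {i j : Fin N}
    (e : ℤ) :
    intForm S (Pi.single i e + Pi.single j 1) = e ^ 2 * S i i + S j j + 2 * e * S i j := by
  have h : (fun k => (((Pi.single i e + Pi.single j 1 : Fin N → ℤ) k : ℤ) : ℝ)) =
      Pi.single i (e : ℝ) + Pi.single j 1 := by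
    funext k
    simp only [Pi.add_apply, Pi.single_apply]
    push_cast
    simp
  have hsym : S j i = S i j := by
    conv_lhs => rw [← hS.transpose_eq]
    rfl
  rw [intForm, h]
  simp [Matrix.mulVec_add, add_dotProduct, hsym]
  ring

theorem intForm_submatrix {S : Matrix (Fin N) (Fin N) ℝ} {n : ℕ} (hn : n ≤ N) {x : Fin N → ℤ}
    (hx : ∀ j : Fin N, n ≤ j → x j = 0) :
    intForm (S.submatrix (Fin.castLE hn) (Fin.castLE hn)) (x ∘ Fin.castLE hn) = intForm S x := by
  have hsum : ∀ f : Fin N → ℝ, (∀ j : Fin N, n ≤ j → f j = 0) →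
      ∑ i : Fin n, f (Fin.castLE hn i) = ∑ i, f i := by
    intro f hf
    refine (Finset.sum_map Finset.univ (Fin.castLEEmb hn) f).symm.trans ?_
    refine Finset.sum_subset (Finset.subset_univ _) fun j _ hj => hf j ?_
    by_contra hlt
    push Not at hlt
    exact hj (Finset.mem_map.2 ⟨⟨j, hlt⟩, Finset.mem_univ _, rfl⟩)
  rw [intForm, intForm, dotProduct_mulVec_eq_sum, dotProduct_mulVec_eq_sum,
    ← hsum _ fun i hi => by simp [hx i hi]]
  refine Finset.sum_congr rfl fun i _ => ?_
  rw [← hsum _ fun j hj => by simp [hx j hj]]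
  rfl

/-- A value of a reduced form smaller than a diagonal entry is a value of the preceding leading
submatrix. -/
theorem Reduced.mem_rep_submatrix {S : Matrix (Fin N) (Fin N) ℝ} (hS : Reduced S) (i : Fin N)
    {x : ℝ} (hx : x ∈ Rep S) (hlt : x < S i i) :
    x ∈ Rep (S.submatrix (Fin.castLE i.2.le) (Fin.castLE i.2.le)) := by
  obtain ⟨v, hv, rfl⟩ := hx
  have h0 : ∀ j : Fin N, i ≤ j → v j = 0 := by
    intro j hij
    by_contra hj
    exact absurd (hS.minimal i v ⟨j, hij, hj⟩) (not_le.2 hlt)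
  refine ⟨v ∘ Fin.castLE i.2.le, fun h => hv ?_, (intForm_submatrix i.2.le h0).symm⟩
  funext j
  by_cases hij : i ≤ j
  · exact h0 j hij
  · exact congrFun h ⟨j, not_le.1 hij⟩

section Entries
variable {S : Matrix (Fin N) (Fin N) ℝ}

theorem diag_mem_rep (i : Fin N) : S i i ∈ Rep S :=
  ⟨Pi.single i 1, by simp, (intForm_single i).symm⟩

theorem pair_mem_rep (hS : S.PosDef) {i j : Fin N} (hij : i ≠ j) :
    S i i + S j j + 2 * S i j ∈ Rep S := by
  refine ⟨Pi.single i 1 + Pi.single j 1, fun h => ?_, ?_⟩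
  · have := congrFun h i
    simp [hij] at this
  · rw [← intForm, intForm_single_add_single hS]
    push_cast
    ring

theorem pair_le (hS : S.PosDef) {i j : Fin N} (hij : i ≠ j) :
    2 * S i j ≤ S i i + S j j := by
  have h := intForm_single_add_single hS (i := i) (j := j) (-1)
  have hpos : 0 < intForm S (Pi.single i (-1) + Pi.single j 1) := by
    apply intForm_pos hS
    intro h
    have := congrFun h i
    simp [hij] at this
  rw [h] at hpos
  push_cast at hpos
  linarith

theorem Reduced.diag_le (hR : Reduced S) {i j : Fin N} (hij : i ≤ j) : S i i ≤ S j j := by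
  rw [← intForm_single (S := S) j]
  exact hR.minimal i _ ⟨j, hij, by simp⟩

theorem Reduced.pair_nonneg (hS : S.PosDef) (hR : Reduced S) {i j : Fin N} (hij : i < j) :
    0 ≤ S i i + 2 * S i j := by
  have := hR.minimal j (Pi.single i 1 + Pi.single j 1) ⟨j, le_rfl, by simp [hij.ne']⟩
  rw [intForm_single_add_single hS] at this
  push_cast at this
  linarith

theorem Reduced.two_mul_le (hS : S.PosDef) (hR : Reduced S) {i j : Fin N} (hij : i < j) :
    2 * S i j ≤ S i i := by
  have := hR.minimal j (Pi.single i (-1) + Pi.single j 1) ⟨j, le_rfl, by simp [hij.ne']⟩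
  rw [intForm_single_add_single hS] at this
  push_cast at this
  linarith

end Entries

/-- The entries that a matrix with values in `L` can have if its diagonal is bounded by `X`. -/
def possibleEntries (L : Set ℝ) (X : ℝ) : Set ℝ :=
  {x ∈ L | x ≤ 4 * X} ∪ (fun r : ℝ × ℝ × ℝ => (r.1 - r.2.1 - r.2.2) / 2) ''
    ({x ∈ L | x ≤ 4 * X} ×ˢ {x ∈ L | x ≤ 4 * X} ×ˢ {x ∈ L | x ≤ 4 * X})

/-- Polarization at e_i + e_j expresses an off-diagonal entry by three values. The bound 4X arises
from 2 S_ij ≤ S_ii + S_jj, that is from positivity at e_i - e_j. -/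
theorem entry_mem_possibleEntries {S : Matrix (Fin N) (Fin N) ℝ} (hS : S.PosDef) {X : ℝ}
    {i j : Fin N} (hi : S i i ≤ X) (hj : S j j ≤ X) : S i j ∈ possibleEntries (Rep S) X := by
  have hi0 : 0 < S i i := hS.diag_pos
  have hj0 : 0 < S j j := hS.diag_pos
  have hmi : S i i ∈ {x ∈ Rep S | x ≤ 4 * X} := ⟨diag_mem_rep i, by linarith⟩
  have hmj : S j j ∈ {x ∈ Rep S | x ≤ 4 * X} := ⟨diag_mem_rep j, by linarith⟩
  by_cases hij : i = j
  · subst hij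
    exact Or.inl hmi
  · refine Or.inr ⟨(S i i + S j j + 2 * S i j, S i i, S j j), ⟨⟨pair_mem_rep hS hij, ?_⟩, hmi, hmj⟩,
      by ring⟩
    have := pair_le hS hij
    linarith

theorem finite_possibleEntries {S : Matrix (Fin N) (Fin N) ℝ} (hS : S.PosDef) (X : ℝ) :
    (possibleEntries (Rep S) X).Finite := by
  have h := finite_rep_le hS (4 * X)
  exact h.union ((h.prod (h.prod h)).image _)

theorem finite_matrices {n : ℕ} {E : Set ℝ} (hE : E.Finite) :
    {A : Matrix (Fin n) (Fin n) ℝ | ∀ i j, A i j ∈ E}.Finite := by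
  have := Set.Finite.pi' fun _ : Fin n => Set.Finite.pi' fun _ : Fin n => hE
  exact this

/-- The diagonal entries of the reduced forms with given values are bounded. -/
theorem exists_diag_bound (hN : N ≤ 4) {S₀ : Matrix (Fin N) (Fin N) ℝ} (hS₀ : S₀.PosDef) :
    ∃ X : ℝ, ∀ S : Matrix (Fin N) (Fin N) ℝ, S.PosDef → Reduced S → Rep S = Rep S₀ →
      ∀ i, S i i ≤ X := by
  suffices H : ∀ n ≤ N, ∃ X : ℝ, ∀ S : Matrix (Fin N) (Fin N) ℝ, S.PosDef → Reduced S →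
      Rep S = Rep S₀ → ∀ i : Fin N, (i : ℕ) < n → S i i ≤ X by
    obtain ⟨X, hX⟩ := H N le_rfl
    exact ⟨X, fun S h1 h2 h3 i => hX S h1 h2 h3 i i.2⟩
  intro n
  induction n with
  | zero => exact fun _ => ⟨0, fun S _ _ _ i hi => absurd hi (by omega)⟩
  | succ n ih =>
    intro hn
    obtain ⟨X, hX⟩ := ih (by omega)
    -- Each possible leading block misses some value of S₀. The next diagonal entry cannot exceed
    -- it, as smaller values come from the block. For n = 0 the block is empty and represents
    -- nothing.
    have hnot : ∀ A : Matrix (Fin n) (Fin n) ℝ, ∃ x, A.PosDef → x ∈ Rep S₀ ∧ x ∉ Rep A := by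
      intro A
      by_cases hA : A.PosDef
      · obtain ⟨x, hx⟩ := Set.not_subset.1 (not_rep_subset (by omega) hN S₀ A hS₀ hA)
        exact ⟨x, fun _ => hx⟩
      · exact ⟨0, fun h => absurd h hA⟩
    choose x hx using hnot
    obtain ⟨Y, hY⟩ := ((finite_matrices (n := n) (finite_possibleEntries hS₀ X)).image x).bddAbove
    refine ⟨max X Y, fun S hS hR hrep i hi => ?_⟩
    rcases Nat.lt_succ_iff_lt_or_eq.1 hi with h | h
    · exact (hX S hS hR hrep i h).trans (le_max_left _ _)
    subst h
    refine le_trans ?_ (le_max_right _ _)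
    set A := S.submatrix (Fin.castLE i.2.le) (Fin.castLE i.2.le)
    have hA : A.PosDef := hS.submatrix (Fin.castLE_injective _)
    obtain ⟨h1, h2⟩ := hx A hA
    refine le_trans ?_ (hY ⟨A, fun j k => ?_, rfl⟩)
    · by_contra hlt
      exact h2 (hR.mem_rep_submatrix i (hrep ▸ h1) (not_le.1 hlt))
    · rw [← hrep]
      exact entry_mem_possibleEntries hS (hX S hS hR hrep _ j.2) (hX S hS hR hrep _ k.2)

theorem finite_reduced (hN : N ≤ 4) {S₀ : Matrix (Fin N) (Fin N) ℝ} (hS₀ : S₀.PosDef) :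
    {S : Matrix (Fin N) (Fin N) ℝ | S.PosDef ∧ Reduced S ∧ Rep S = Rep S₀}.Finite := by
  obtain ⟨X, hX⟩ := exists_diag_bound hN hS₀
  refine (finite_matrices (finite_possibleEntries hS₀ X)).subset ?_
  rintro S ⟨hS, hR, hrep⟩ i j
  rw [← hrep]
  exact entry_mem_possibleEntries hS (hX S hS hR hrep i) (hX S hS hR hrep j)

theorem finite_classes (hN : N ≤ 4) (L : Set ℝ) :
    {X : Quotient (equivSetoid N) | ∃ S : Matrix (Fin N) (Fin N) ℝ, S.PosDef ∧ Rep S = L ∧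
      X = Quotient.mk (equivSetoid N) S}.Finite := by
  by_cases h : ∃ S₀ : Matrix (Fin N) (Fin N) ℝ, S₀.PosDef ∧ Rep S₀ = L
  · obtain ⟨S₀, hS₀, rfl⟩ := h
    refine ((finite_reduced hN hS₀).image (Quotient.mk (equivSetoid N))).subset ?_
    rintro _ ⟨S, hS, hrep, rfl⟩
    obtain ⟨T, hT, hR⟩ := exists_reduced hS hN
    exact ⟨T, ⟨hT.posDef hS, hR, hT.rep_eq.trans hrep⟩, Quotient.sound hT.symm⟩
  · convert! Set.finite_empty
    ext X
    simp only [Set.mem_empty_iff_false, iff_false]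
    rintro ⟨S, hS, hrep, -⟩
    exact h ⟨S, hS, hrep⟩

end Finiteness

/-! ### Sorted listings -/

/-- The set is order isomorphic to its image in `ℕ`, which `Nat.nth` enumerates from 0; the listing
is this enumeration shifted to start at 1. -/
theorem isSortedListing_of_strictMono_nat {A : Set ℝ} {f : ℝ → ℕ} (hf : StrictMonoOn f A) :
    ∃ (M : ℕ∞) (q : ℕ → ℝ), IsSortedListing A M q := by
  classical
  set B : Set ℕ := f '' A with hB
  set p : ℕ → Prop := fun n => n ∈ B with hp
  have hof : Set.ofPred p = B := rfl
  choose! g hgA hgf using fun n (h : n ∈ B) => h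
  have hgmono : StrictMonoOn g B := by
    intro m hm n hn hmn
    rw [← hf.lt_iff_lt (hgA m hm) (hgA n hn), hgf m hm, hgf n hn]
    exact hmn
  have hgim : g '' B = A := by
    ext x
    constructor
    · rintro ⟨n, hn, rfl⟩
      exact hgA n hn
    · intro hx
      have hfx : f x ∈ B := ⟨x, hx, rfl⟩
      exact ⟨f x, hfx, hf.injOn (hgA _ hfx) hx (hgf _ hfx)⟩
  have key : ∀ (M : ℕ∞) (I : Set ℕ), StrictMonoOn (Nat.nth p) I → Nat.nth p '' I = B →
      (∀ i : ℕ, 1 ≤ i ∧ (i : ℕ∞) ≤ M ↔ ∃ j ∈ I, i = j + 1) →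
      ∃ (M : ℕ∞) (q : ℕ → ℝ), IsSortedListing A M q := by
    intro M I hmono him hI
    refine ⟨M, fun i => g (Nat.nth p (i - 1)), ?_, ?_⟩
    · intro i hi j hj hij
      obtain ⟨i', hi', rfl⟩ := (hI i).1 hi
      obtain ⟨j', hj', rfl⟩ := (hI j).1 hj
      simp only [Nat.add_sub_cancel]
      refine hgmono ?_ ?_ (hmono hi' hj' (by omega)) <;> rw [← him]
      · exact ⟨i', hi', rfl⟩
      · exact ⟨j', hj', rfl⟩
    · rw [← hgim, ← him]
      ext x
      constructor
      · rintro ⟨i, hi, rfl⟩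
        obtain ⟨i', hi', rfl⟩ := (hI i).1 hi
        exact ⟨_, ⟨i', hi', rfl⟩, rfl⟩
      · rintro ⟨_, ⟨i', hi', rfl⟩, rfl⟩
        exact ⟨i' + 1, (hI _).2 ⟨i', hi', rfl⟩, rfl⟩
  by_cases hfin : (Set.ofPred p).Finite
  · refine key hfin.toFinset.card _ (Nat.nth_strictMonoOn hfin) (Nat.image_nth_Iio_card hfin)
      fun i => ?_
    rw [Nat.cast_le]
    constructor
    · rintro ⟨h1, h2⟩
      exact ⟨i - 1, by simp only [Set.mem_Iio]; omega, by omega⟩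
    · rintro ⟨j, hj, rfl⟩
      simp only [Set.mem_Iio] at hj
      omega
  · refine key ⊤ Set.univ ((Nat.nth_strictMono hfin).strictMonoOn _) ?_ fun i => ?_
    · rw [Set.image_univ, Nat.range_nth_of_infinite hfin, hof]
    · constructor
      · rintro ⟨h1, -⟩
        exact ⟨i - 1, trivial, by omega⟩
      · rintro ⟨j, -, rfl⟩
        exact ⟨by omega, le_top⟩

/-- A set of reals with finite initial segments has a sorted listing. -/
theorem exists_isSortedListing {A : Set ℝ} (hA : ∀ X : ℝ, {x ∈ A | x ≤ X}.Finite) :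
    ∃ (M : ℕ∞) (q : ℕ → ℝ), IsSortedListing A M q := by
  refine isSortedListing_of_strictMono_nat (f := fun x => {y ∈ A | y ≤ x}.ncard) ?_
  intro x hx y hy hxy
  refine Set.ncard_lt_ncard ⟨fun z hz => ⟨hz.1, hz.2.trans hxy.le⟩, fun h => ?_⟩ (hA y)
  exact absurd (h ⟨hy, le_rfl⟩).2 (not_le.2 hxy)

/-! ### Correctness of the recursive procedure -/

/-- A symmetric matrix with positive determinant and positive definite leading block is positive
definite. -/
theorem posDef_of_leading {n : ℕ} (A : Matrix (Fin (n + 1)) (Fin (n + 1)) ℝ) (hA : Aᵀ = A)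
    (hlead : (A.submatrix Fin.castSucc Fin.castSucc).PosDef) (hdet : 0 < A.det) : A.PosDef := by
  set e : Fin n ⊕ Fin 1 ≃ Fin (n + 1) := finSumFinEquiv with he
  set A₁ := A.submatrix Fin.castSucc Fin.castSucc with hA₁
  set B : Matrix (Fin n) (Fin 1) ℝ := A.submatrix Fin.castSucc (fun _ => Fin.last n) with hB
  set D : Matrix (Fin 1) (Fin 1) ℝ := A.submatrix (fun _ => Fin.last n) (fun _ => Fin.last n)
  have hinl : ∀ i : Fin n, e (Sum.inl i) = i.castSucc := fun i => rfl
  have hinr : ∀ i : Fin 1, e (Sum.inr i) = Fin.last n := fun i => by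
    ext; simp [he]
  have hblock : A.submatrix e e = Matrix.fromBlocks A₁ B Bᴴ D := by
    ext i j
    rcases i with i | i <;> rcases j with j | j <;>
      simp only [Matrix.submatrix_apply, hinl, hinr, Matrix.fromBlocks_apply₁₁,
        Matrix.fromBlocks_apply₁₂, Matrix.fromBlocks_apply₂₁, Matrix.fromBlocks_apply₂₂] <;>
      try rfl
    conv_lhs => rw [← hA]
    simp [hB]
  have hdet' : (A.submatrix e e).det = A.det := Matrix.det_submatrix_equiv_self e A
  have hinv : Invertible A₁ := hlead.isUnit.invertible
  rw [hblock, Matrix.det_fromBlocks₁₁, Matrix.invOf_eq_nonsing_inv] at hdet'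
  -- The determinant is that of the leading block times the Schur complement, a single number, which
  -- is therefore positive.
  have hschur : 0 < (D - Bᴴ * A₁⁻¹ * B).det := by
    rw [← hdet'] at hdet
    exact (mul_pos_iff_of_pos_left hlead.det_pos).1 hdet
  have hpsd : (A.submatrix e e).PosSemidef := by
    rw [hblock, Matrix.PosDef.fromBlocks₁₁ _ _ hlead]
    rw [Matrix.det_fin_one] at hschur
    have : D - Bᴴ * A₁⁻¹ * B = Matrix.diagonal fun _ => (D - Bᴴ * A₁⁻¹ * B) 0 0 := by
      ext i j
      fin_cases i; fin_cases j
      simp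
    rw [this]
    exact Matrix.PosSemidef.diagonal fun _ => hschur.le
  rw [Matrix.posSemidef_submatrix_equiv] at hpsd
  exact hpsd.posDef_iff_det_ne_zero.2 hdet.ne'

/-- The indices of a sequence of length `M` that starts at `1`. -/
def indexSet (M : ℕ∞) : Set ℕ := {i | 1 ≤ i ∧ (i : ℕ∞) ≤ M}

/-- What the procedure needs to know about the sequence of values. -/
structure Admissible (N : ℕ) (M : ℕ∞) (q : ℕ → ℝ) : Prop where
  mono : StrictMonoOn q (indexSet M)
  pos : ∀ i ∈ indexSet M, 0 < q i
  one_mem : 1 ∈ indexSet M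
  bddAbove_le : ∀ X : ℝ, BddAbove {i : ℕ | 1 ≤ i ∧ (i : ℕ∞) ≤ M ∧ q i ≤ X}
  bddAbove_rep : ∀ n < N, 0 < n → ∀ A : Matrix (Fin n) (Fin n) ℝ, A.PosDef →
    BddAbove {i : ℕ | 1 ≤ i ∧ (i : ℕ∞) ≤ M ∧ ∀ j : ℕ, 1 ≤ j → j < i → q j ∈ Rep A}

/-- The quantity that the pass with counter `l` makes equal to `q_l`. -/
def passValue (R : ℕ → ℕ → ℝ) (m n : ℕ) : ℝ :=
  if m = n then R n n else R m m + R n n + 2 * R m n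

/-- The arrays that the procedure finds. -/
structure Target (N : ℕ) (M : ℕ∞) (q : ℕ → ℝ) (R : ℕ → ℕ → ℝ) : Prop where
  symm : ∀ i j, R i j = R j i
  first : R 1 1 = q 1
  listed : ∀ m n, 1 ≤ m → m ≤ n → n ≤ N → ∃ l ∈ indexSet M, passValue R m n = q l
  mono : ∀ n, 1 ≤ n → n + 1 ≤ N → R n n ≤ R (n + 1) (n + 1)
  nonneg : ∀ m n, 1 ≤ m → m < n → n ≤ N → 0 ≤ R m m + 2 * R m n
  obtuse : ∀ n, 1 ≤ n → n + 1 ≤ N → R n (n + 1) ≤ 0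
  le : ∀ m n, 1 ≤ m → m < n → n ≤ N → 2 * R m n ≤ R m m
  gap : ∀ n, 1 ≤ n → n + 1 ≤ N → ∀ j ∈ indexSet M, q j < R (n + 1) (n + 1) → q j ∈ Rep (lead R n)
  det_pos : ∀ n ≤ N, 0 < (lead R n).det

/-- Execution from `C` is completed, inserts only positive definite matrices, and inserts every
target that satisfies `P`. -/
def Outcome (N : ℕ) (M : ℕ∞) (q : ℕ → ℝ) (C : Config) (P : (ℕ → ℕ → ℝ) → Prop) : Prop :=
  ∃ (k : ℕ) (Ans : List (Matrix (Fin N) (Fin N) ℝ)), Exec N M q C k Ans ∧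
    (∀ A ∈ Ans, A.PosDef) ∧ ∀ R, Target N M q R → P R → lead R N ∈ Ans

/-- `R` and `S` agree in the entries `(i, j)` with `i, j < n`, and `(i, n)` with `m < i ≤ n`. -/
def Compatible (m n : ℕ) (S R : ℕ → ℕ → ℝ) : Prop :=
  (∀ i j, 1 ≤ i → i < n → 1 ≤ j → j < n → R i j = S i j) ∧ ∀ i, m < i → i ≤ n → R i n = S i n

section Procedure
variable {N : ℕ} {M : ℕ∞} {q : ℕ → ℝ}

theorem Outcome.mono {C : Config} {P P' : (ℕ → ℕ → ℝ) → Prop} (h : Outcome N M q C P)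
    (hP : ∀ R, Target N M q R → P' R → P R) : Outcome N M q C P' := by
  obtain ⟨k, Ans, h1, h2, h3⟩ := h
  exact ⟨k, Ans, h1, h2, fun R hR hR' => h3 R hR (hP R hR hR')⟩

theorem outcome_loop (m n : ℕ) (S : ℕ → ℕ → ℝ) (I l J : ℕ) (P : ℕ → (ℕ → ℕ → ℝ) → Prop)
    (h : ∀ l', l ≤ l' → l' ≤ J →
      Outcome N M q (Config.body m n (assign S m n (newEntry q S m n l')) I l') (P l')) :
    Outcome N M q (Config.loop m n S I l J) fun R => ∃ l', l ≤ l' ∧ l' ≤ J ∧ P l' R := by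
  induction hd : J + 1 - l generalizing l with
  | zero =>
    refine ⟨1, [], Exec.loop_end m n S I l J (by omega), by simp, ?_⟩
    rintro R - ⟨l', h1, h2, -⟩
    omega
  | succ d ih =>
    obtain ⟨k₁, Ans₁, h1, h2, h3⟩ := h l le_rfl (by omega)
    obtain ⟨k₂, Ans₂, g1, g2, g3⟩ := ih (l + 1) (fun l' h1 h2 => h l' (by omega) h2) (by omega)
    refine ⟨_, _, Exec.loop_pass m n S I l J k₁ k₂ Ans₁ Ans₂ (by omega) h1 g1, ?_, ?_⟩
    · intro A hA
      exact (List.mem_append.1 hA).elim (h2 A) (g2 A)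
    · rintro R hR ⟨l', e1, e2, e3⟩
      rw [List.mem_append]
      rcases eq_or_lt_of_le e1 with rfl | hlt
      · exact Or.inl (h3 R hR e3)
      · exact Or.inr (g3 R hR ⟨l', hlt, e2, e3⟩)

theorem lead_congr {S R : ℕ → ℕ → ℝ} {n : ℕ}
    (h : ∀ i j, 1 ≤ i → i ≤ n → 1 ≤ j → j ≤ n → R i j = S i j) : lead R n = lead S n := by
  ext i j
  exact h _ _ (by omega) (by omega) (by omega) (by omega)

theorem Compatible.lead_eq {S R : ℕ → ℕ → ℝ} {n : ℕ} (hR : ∀ i j, R i j = R j i)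
    (hS : ∀ i, 1 ≤ i → i ≤ n → S i n = S n i) (h : Compatible 0 n S R) : lead R n = lead S n := by
  refine lead_congr fun i j hi hin hj hjn => ?_
  rcases eq_or_lt_of_le hin with rfl | hi'
  · rw [hR, h.2 j (by omega) hjn, hS j hj hjn]
  · rcases eq_or_lt_of_le hjn with rfl | hj'
    · exact h.2 i (by omega) hin
    · exact h.1 i j hi hi' hj hj'

theorem lead_posDef {S : ℕ → ℕ → ℝ} {n : ℕ} (hn : 1 ≤ n) (hlead : (lead S (n - 1)).PosDef)
    (hS : ∀ i, 1 ≤ i → i ≤ n → S i n = S n i) (hdet : 0 < (lead S n).det) : (lead S n).PosDef := by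
  obtain ⟨n, rfl⟩ := Nat.exists_eq_add_of_le' hn
  rw [Nat.add_sub_cancel] at hlead
  have hsub : (lead S (n + 1)).submatrix Fin.castSucc Fin.castSucc = lead S n := by
    ext i j; rfl
  refine posDef_of_leading _ ?_ (by rwa [hsub]) hdet
  ext i j
  simp only [Matrix.transpose_apply, lead, Matrix.of_apply]
  have hsym := hlead.transpose_eq
  rcases eq_or_lt_of_le (Nat.lt_succ_iff.1 i.2) with hi | hi
  · rw [hi]
    exact hS (j + 1) (by omega) (by omega)
  · rcases eq_or_lt_of_le (Nat.lt_succ_iff.1 j.2) with hj | hj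
    · rw [hj]
      exact (hS (i + 1) (by omega) (by omega)).symm
    · exact congrFun (congrFun hsym ⟨i, hi⟩) ⟨j, hj⟩

theorem exists_isGreatest_of_bddAbove {s : Set ℕ} (h : BddAbove s) (h1 : s.Nonempty) :
    ∃ m, IsGreatest s m :=
  ⟨sSup s, Nat.sSup_mem h1 h, fun _ hx => le_csSup h hx⟩

/-- The state before the pass with counter in `(m, n)` assigns `s_{mn}`. -/
structure LoopState (M : ℕ∞) (q : ℕ → ℝ) (m n : ℕ) (S : ℕ → ℕ → ℝ) (I : ℕ) : Prop where
  lead_posDef : (lead S (n - 1)).PosDef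
  symm : ∀ i, m < i → i ≤ n → S i n = S n i
  start : I ∈ indexSet M
  diag : m < n → S n n = q I

/-- The state after the pass with counter `l` assigned `s_{mn}`. -/
structure BodyState (M : ℕ∞) (q : ℕ → ℝ) (m n : ℕ) (S : ℕ → ℕ → ℝ) (I : ℕ) : Prop where
  lead_posDef : (lead S (n - 1)).PosDef
  symm : ∀ i, m ≤ i → i ≤ n → S i n = S n i
  start : I ∈ indexSet M
  diag : S n n = q I

/-- The conclusion for a call with arguments `m, n`. -/
def CallCompletes (N : ℕ) (M : ℕ∞) (q : ℕ → ℝ) (m n : ℕ) : Prop :=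
  ∀ (S : ℕ → ℕ → ℝ) (I J : ℕ), LoopState M q m n S I → (J : ℕ∞) ≤ M →
    Outcome N M q (call m n S I J) fun R =>
      Compatible m n S R ∧ ∃ l, I ≤ l ∧ l ≤ J ∧ passValue R m n = q l

/-- The conclusion for the rest of a pass that has assigned `s_{mn}`. -/
def BodyCompletes (N : ℕ) (M : ℕ∞) (q : ℕ → ℝ) (m n : ℕ) : Prop :=
  ∀ (S : ℕ → ℕ → ℝ) (I l : ℕ), BodyState M q m n S (if m = n then l else I) →
    Outcome N M q (Config.body m n S I l) (Compatible (m - 1) n S)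

/-- `newEntry` inverts `passValue`: the pass whose counter l satisfies q_l = `passValue R m n`
writes exactly the entry of R, since the diagonal entries it uses already agree. -/
theorem callCompletes_of_body {m n : ℕ} (hm : 1 ≤ m) (hmn : m ≤ n)
    (h : BodyCompletes N M q m n) : CallCompletes N M q m n := by
  intro S I J hS hJ
  refine (outcome_loop m n S I I J (fun l => Compatible (m - 1) n
    (assign S m n (newEntry q S m n l))) fun l hIl hlJ => h _ I l ?_).mono ?_
  · have hl : l ∈ indexSet M := ⟨hS.start.1.trans hIl, le_trans (by exact_mod_cast hlJ) hJ⟩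
    refine ⟨?_, fun i hi hin => ?_, ?_, ?_⟩
    · have : lead (assign S m n (newEntry q S m n l)) (n - 1) = lead S (n - 1) := by
        refine lead_congr fun i j _ hi _ hj => ?_
        rw [assign, if_neg]
        omega
      rw [this]
      exact hS.lead_posDef
    · unfold assign
      rcases eq_or_lt_of_le hi with rfl | hlt
      · simp
      · by_cases hc : (i = m ∧ n = n) ∨ (i = n ∧ n = m)
        · rw [if_pos hc, if_pos (by tauto)]
        · rw [if_neg hc, if_neg (by tauto)]
          exact hS.symm i hlt hin
    · split_ifs
      · exact hl
      · exact hS.start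
    · by_cases hc : m = n
      · subst hc
        simp [assign, newEntry]
      · rw [if_neg hc, assign, if_neg (by omega)]
        exact hS.diag (by omega)
  · rintro R hR ⟨⟨hc1, hc2⟩, l, hIl, hlJ, hval⟩
    refine ⟨l, hIl, hlJ, fun i j hi hin hj hjn => ?_, fun i hi hin => ?_⟩
    · rw [assign, if_neg (by omega)]
      exact hc1 i j hi hin hj hjn
    · rcases eq_or_lt_of_le (show m ≤ i by omega) with rfl | hlt
      · rw [assign, if_pos (by tauto)]
        unfold passValue at hval
        unfold newEntry
        by_cases hmn' : m = n
        · subst hmn'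
          simpa using hval
        · rw [if_neg hmn'] at hval ⊢
          rw [← hval, hc1 m m hm (by omega) hm (by omega), hc2 n (by omega) le_rfl]
          ring
      · rw [assign, if_neg (by omega)]
        exact hc2 i hlt hin

/-- The next loop must contain the index of s_kk + s_nn + 2 s_kn with k = m - 1. The lower end
follows from s_kk + 2 s_kn ≥ 0; the upper end from s_kn ≤ 0 next to the diagonal and from 2 s_kn ≤
s_kk elsewhere. -/
theorem bodyCompletes_of_call_row (hq : Admissible N M q) {m n : ℕ} (hm : 1 < m) (hmn : m ≤ n)
    (hn : n ≤ N) (h : CallCompletes N M q (m - 1) n) : BodyCompletes N M q m n := by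
  intro S I l hS
  set I' := if m = n then l else I with hI'
  have hdiag : 0 < S (m - 1) (m - 1) := by
    have := hS.lead_posDef.diag_pos (i := ⟨m - 2, by omega⟩)
    simp only [lead, Matrix.of_apply] at this
    rwa [show m - 2 + 1 = m - 1 by omega] at this
  have hq1 : q 1 ≤ S n n := by
    rw [hS.diag]
    exact (hq.mono.le_iff_le hq.one_mem hS.start).2 hS.start.1
  have hloop : LoopState M q (m - 1) n S I' :=
    ⟨hS.lead_posDef, fun i hi hin => hS.symm i (by omega) hin, hS.start, fun _ => hS.diag⟩
  have htarget : ∀ (m₂ : ℕ) (X : ℝ), IsGreatest {i : ℕ | 1 ≤ i ∧ (i : ℕ∞) ≤ M ∧ q i ≤ X} m₂ →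
      ∀ R, Target N M q R → Compatible (m - 1) n S R → passValue R (m - 1) n ≤ X →
      ∃ l, I' ≤ l ∧ l ≤ m₂ ∧ passValue R (m - 1) n = q l := by
    intro m₂ X hm₂ R hR hc hX
    obtain ⟨l₀, hl₀, hv⟩ := hR.listed (m - 1) n (by omega) (by omega) hn
    refine ⟨l₀, ?_, hm₂.2 ⟨hl₀.1, hl₀.2, by rw [← hv]; exact hX⟩, hv⟩
    rw [← hq.mono.le_iff_le hS.start hl₀, ← hv, ← hS.diag, ← hc.2 n (by omega) le_rfl, passValue,
      if_neg (by omega)]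
    have := hR.nonneg (m - 1) n (by omega) (by omega) hn
    linarith
  by_cases hmn' : m = n
  · obtain ⟨m₂, hm₂⟩ := exists_isGreatest_of_bddAbove (hq.bddAbove_le (S (n - 1) (n - 1) + S n n))
      ⟨1, hq.one_mem.1, hq.one_mem.2, by rw [hmn'] at hdiag; linarith⟩
    obtain ⟨k, Ans, h1, h2, h3⟩ := h S I' m₂ hloop hm₂.1.2.1
    rw [hI', if_pos hmn'] at h1
    refine ⟨_, Ans, Exec.next_row_diag m n S I l m₂ k Ans (by omega) hmn' hm₂ h1, h2, ?_⟩
    intro R hR hc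
    refine h3 R hR ⟨hc, htarget m₂ _ hm₂ R hR hc ?_⟩
    have h4 := hR.obtuse (n - 1) (by omega) (by omega)
    have h5 := hc.1 (m - 1) (m - 1) (by omega) (by omega) (by omega) (by omega)
    have h6 := hc.2 n (by omega) le_rfl
    rw [show n - 1 + 1 = n by omega] at h4
    rw [passValue, if_neg (by omega)]
    rw [hmn'] at h5 ⊢
    linarith
  · obtain ⟨m₂, hm₂⟩ := exists_isGreatest_of_bddAbove
      (hq.bddAbove_le (2 * S (m - 1) (m - 1) + S n n))
      ⟨1, hq.one_mem.1, hq.one_mem.2, by linarith⟩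
    obtain ⟨k, Ans, h1, h2, h3⟩ := h S I' m₂ hloop hm₂.1.2.1
    rw [hI', if_neg hmn'] at h1
    refine ⟨_, Ans, Exec.next_row m n S I l m₂ k Ans (by omega) hmn' hm₂ h1, h2, ?_⟩
    intro R hR hc
    refine h3 R hR ⟨hc, htarget m₂ _ hm₂ R hR hc ?_⟩
    have h4 := hR.le (m - 1) n (by omega) (by omega) hn
    have h5 := hc.1 (m - 1) (m - 1) (by omega) (by omega) (by omega) (by omega)
    have h6 := hc.2 n (by omega) le_rfl
    rw [passValue, if_neg (by omega)]
    linarith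

/-- The diagonal of a target is monotone, which justifies the start of the next loop. All listed
values below the next diagonal entry are represented by the present block, which justifies its end.
-/
theorem bodyCompletes_of_call_rank (hq : Admissible N M q) {n : ℕ} (hn1 : 1 ≤ n) (hn : n ≤ N)
    (h : n < N → CallCompletes N M q (n + 1) (n + 1)) : BodyCompletes N M q 1 n := by
  intro S I l hS
  have hcl : ∀ R, Target N M q R → Compatible (1 - 1) n S R → lead R n = lead S n :=
    fun R hR hc => hc.lead_eq hR.symm fun i hi hin => hS.symm i hi hin
  by_cases hdet : 0 < (lead S n).det
  · have hpd : (lead S n).PosDef := lead_posDef hn1 hS.lead_posDef (fun i => hS.symm i) hdet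
    rcases eq_or_lt_of_le hn with rfl | hlt
    · exact ⟨1, _, Exec.insert 1 n S I l rfl hdet le_rfl, by simpa using hpd,
        fun R hR hc => by simpa using hcl R hR hc⟩
    · obtain ⟨m₂, hm₂⟩ := exists_isGreatest_of_bddAbove (hq.bddAbove_rep n hlt hn1 _ hpd)
        ⟨1, hq.one_mem.1, hq.one_mem.2, fun j hj hj' => by omega⟩
      obtain ⟨k, Ans, h1, h2, h3⟩ := h hlt S (if 1 = n then l else I) m₂
        ⟨by simpa using hpd, fun i hi hin => by omega, hS.start, fun h => by omega⟩ hm₂.1.2.1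
      refine ⟨_, Ans, Exec.next_rank 1 n S I l m₂ k Ans rfl hdet hlt hm₂ h1, h2, ?_⟩
      intro R hR hc
      have hlead := hcl R hR hc
      have hent : ∀ i j, 1 ≤ i → i ≤ n → 1 ≤ j → j ≤ n → R i j = S i j := by
        intro i j hi hin hj hjn
        have := congrFun (congrFun hlead ⟨i - 1, by omega⟩) ⟨j - 1, by omega⟩
        simp only [lead, Matrix.of_apply] at this
        rwa [show i - 1 + 1 = i by omega, show j - 1 + 1 = j by omega] at this
      refine h3 R hR ⟨⟨fun i j hi hin hj hjn => hent i j hi (by omega) hj (by omega),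
        fun i hi hin => by omega⟩, ?_⟩
      obtain ⟨l₀, hl₀, hv⟩ := hR.listed (n + 1) (n + 1) (by omega) le_rfl hlt
      have hv' : R (n + 1) (n + 1) = q l₀ := by simpa [passValue] using hv
      refine ⟨l₀, ?_, hm₂.2 ⟨hl₀.1, hl₀.2, fun j hj hjl => ?_⟩, hv⟩
      · rw [← hq.mono.le_iff_le hS.start hl₀, ← hv', ← hS.diag, ← hent n n hn1 le_rfl hn1 le_rfl]
        exact hR.mono n hn1 hlt
      · have hjM : j ∈ indexSet M := ⟨hj, le_trans (by exact_mod_cast hjl.le) hl₀.2⟩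
        rw [← hlead]
        exact hR.gap n hn1 hlt j hjM (by rw [hv']; exact hq.mono hjM hl₀ hjl)
  · refine ⟨1, [], Exec.reject 1 n S I l rfl hdet, by simp, fun R hR hc => ?_⟩
    have := hR.det_pos n hn
    rw [hcl R hR hc] at this
    exact absurd this hdet

/-- Calls lead from (m, n) to (m - 1, n) and from (1, n) to (n + 1, n + 1), so the induction runs on
N - n and, inside, on m. -/
theorem callCompletes (hq : Admissible N M q) (n : ℕ) (hn1 : 1 ≤ n) (hn : n ≤ N) (m : ℕ)
    (hm : 1 ≤ m) (hmn : m ≤ n) : CallCompletes N M q m n := by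
  induction hd : N - n generalizing n m with
  | zero =>
    induction m, hm using Nat.le_induction with
    | base =>
      exact callCompletes_of_body le_rfl hmn
        (bodyCompletes_of_call_rank hq hn1 hn fun h => by omega)
    | succ m hm ih =>
      exact callCompletes_of_body (by omega) hmn
        (bodyCompletes_of_call_row hq (by omega) hmn hn (ih (by omega)))
  | succ d ihd =>
    induction m, hm using Nat.le_induction with
    | base =>
      exact callCompletes_of_body le_rfl hmn
        (bodyCompletes_of_call_rank hq hn1 hn fun h =>
          ihd (n + 1) (by omega) h (n + 1) (by omega) le_rfl (by omega))
    | succ m hm ih =>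
      exact callCompletes_of_body (by omega) hmn
        (bodyCompletes_of_call_row hq (by omega) hmn hn (ih (by omega)))

/-- The procedure is completed, inserts only positive definite matrices, and inserts every
target. -/
theorem exec_procedure (hN : 0 < N) (hq : Admissible N M q) (T : ℕ → ℕ → ℝ) :
    ∃ (k : ℕ) (Ans : List (Matrix (Fin N) (Fin N) ℝ)), Exec N M q (call 1 1 T 1 1) k Ans ∧
      (∀ A ∈ Ans, A.PosDef) ∧ ∀ R, Target N M q R → lead R N ∈ Ans := by
  have hpd : (lead T (1 - 1)).PosDef :=
    posDef_of_qf_pos (by ext i; exact i.elim0) fun v hv => absurd (funext fun i => i.elim0) hv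
  obtain ⟨k, Ans, h1, h2, h3⟩ := callCompletes hq 1 le_rfl hN 1 le_rfl le_rfl T 1 1
    ⟨hpd, fun i hi hin => by omega, hq.one_mem, fun h => by omega⟩ hq.one_mem.2
  refine ⟨k, Ans, h1, h2, fun R hR => h3 R hR ⟨⟨fun i j hi hin => by omega,
    fun i hi hin => by omega⟩, 1, le_rfl, le_rfl, ?_⟩⟩
  simpa [passValue] using hR.first

end Procedure

/-! ### Listed values of a form and reduced matrices as targets -/

section Observed
variable {N : ℕ} {S₀ : Matrix (Fin N) (Fin N) ℝ} {c : EReal} {M : ℕ∞} {q : ℕ → ℝ}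

theorem exists_listing_observed (hS₀ : S₀.PosDef) (c : EReal) :
    ∃ (M : ℕ∞) (q : ℕ → ℝ), IsSortedListing (Observed S₀ c) M q :=
  exists_isSortedListing fun X => (finite_rep_le hS₀ X).subset fun _ hx => ⟨hx.1.1, hx.2⟩

theorem mem_observed_of_listing (hq : IsSortedListing (Observed S₀ c) M q) {i : ℕ}
    (hi : i ∈ indexSet M) : q i ∈ Observed S₀ c :=
  hq.2 ▸ ⟨i, hi, rfl⟩

theorem exists_index_of_listing (hq : IsSortedListing (Observed S₀ c) M q) {x : ℝ}
    (hx : x ∈ Observed S₀ c) : ∃ i ∈ indexSet M, q i = x := by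
  rw [← hq.2] at hx
  exact hx

theorem rep_pos (hS₀ : S₀.PosDef) {x : ℝ} (hx : x ∈ Rep S₀) : 0 < x := by
  obtain ⟨v, hv, rfl⟩ := hx
  exact intForm_pos hS₀ hv

theorem admissible_of_listing (hN : N ≤ 4) (hS₀ : S₀.PosDef) (hne : (Observed S₀ c).Nonempty)
    (hq : IsSortedListing (Observed S₀ c) M q) : Admissible N M q := by
  have hbdd : ∀ X : ℝ, BddAbove {i : ℕ | 1 ≤ i ∧ (i : ℕ∞) ≤ M ∧ q i ≤ X} := by
    intro X
    refine (Set.Finite.of_finite_image (f := q) ((finite_rep_le hS₀ X).subset ?_) ?_).bddAbove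
    · rintro _ ⟨i, ⟨h1, h2, h3⟩, rfl⟩
      exact ⟨(mem_observed_of_listing hq ⟨h1, h2⟩).1, h3⟩
    · exact fun i hi j hj h => hq.1.injOn (show i ∈ indexSet M from ⟨hi.1, hi.2.1⟩)
        (show j ∈ indexSet M from ⟨hj.1, hj.2.1⟩) h
  refine ⟨hq.1, fun i hi => (mem_observed_of_listing hq hi).2.1, ?_, hbdd, ?_⟩
  · obtain ⟨x, hx⟩ := hne
    obtain ⟨i, ⟨h1, h2⟩, -⟩ := exists_index_of_listing hq hx
    exact ⟨le_rfl, le_trans (by exact_mod_cast h1) h2⟩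
  -- If the block A had no upper end, there would be infinitely many listed values, so none of the
  -- values of S₀ could lie at or above c; each would be listed and represented by A, against the
  -- rank comparison.
  · intro n hn _ A hA
    by_contra hcon
    rw [not_bddAbove_iff] at hcon
    refine not_rep_subset hn hN S₀ A hS₀ hA fun x hx => ?_
    have hxc : (x : EReal) < c := by
      by_contra hle
      obtain ⟨B, hB⟩ := hbdd x
      obtain ⟨i, ⟨h1, h2, -⟩, hi⟩ := hcon B
      have hlt : (q i : EReal) < x :=
        (mem_observed_of_listing hq ⟨h1, h2⟩).2.2.trans_le (not_lt.1 hle)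
      exact absurd (hB ⟨h1, h2, (EReal.coe_lt_coe_iff.1 hlt).le⟩) (not_le.2 hi)
    obtain ⟨j, hj, rfl⟩ := exists_index_of_listing hq ⟨hx, rep_pos hS₀ hx, hxc⟩
    obtain ⟨i, ⟨-, -, h3⟩, hi⟩ := hcon j
    exact h3 j hj.1 hi

/-- The array, with indices starting at `1`, of the entries of a matrix. -/
def toArray (S : Matrix (Fin N) (Fin N) ℝ) (i j : ℕ) : ℝ :=
  if h : (1 ≤ i ∧ i ≤ N) ∧ (1 ≤ j ∧ j ≤ N) then S ⟨i - 1, by omega⟩ ⟨j - 1, by omega⟩ else 0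

theorem toArray_apply (S : Matrix (Fin N) (Fin N) ℝ) {i j : ℕ} (hi : 1 ≤ i) (hi' : i ≤ N)
    (hj : 1 ≤ j) (hj' : j ≤ N) :
    toArray S i j = S ⟨i - 1, by omega⟩ ⟨j - 1, by omega⟩ := by
  rw [toArray, dif_pos ⟨⟨hi, hi'⟩, hj, hj'⟩]

theorem lead_toArray (S : Matrix (Fin N) (Fin N) ℝ) {n : ℕ} (hn : n ≤ N) :
    lead (toArray S) n = S.submatrix (Fin.castLE hn) (Fin.castLE hn) := by
  ext i j
  simp only [lead, Matrix.of_apply, Matrix.submatrix_apply]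
  rw [toArray_apply S (by omega) (by omega) (by omega) (by omega)]
  rfl

/-- The bound by c makes every quantity met in a pass a listed value; the other conditions come from
reduction and positivity. -/
theorem target_of_reduced (hN : 0 < N) (hq : IsSortedListing (Observed S₀ c) M q)
    {S : Matrix (Fin N) (Fin N) ℝ} (hS : S.PosDef) (hR : Reduced S) (hrep : Rep S = Rep S₀)
    (hc : ∀ i j, i ≤ j → ((if i = j then S i i else S i i + S j j + 2 * S i j : ℝ) : EReal) < c) :
    Target N M q (toArray S) := by
  have hobs : ∀ x ∈ Rep S, (x : EReal) < c → x ∈ Observed S₀ c := fun x hx hxc =>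
    ⟨hrep ▸ hx, rep_pos hS hx, hxc⟩
  have hlisted : ∀ m n, 1 ≤ m → m ≤ n → n ≤ N →
      ∃ l ∈ indexSet M, passValue (toArray S) m n = q l := by
    intro m n hm hmn hn
    have hlt := hc ⟨m - 1, by omega⟩ ⟨n - 1, by omega⟩ (by rw [Fin.mk_le_mk]; omega)
    rw [passValue, toArray_apply S hm (hmn.trans hn) hm (hmn.trans hn),
      toArray_apply S (hm.trans hmn) hn (hm.trans hmn) hn,
      toArray_apply S hm (hmn.trans hn) (hm.trans hmn) hn]
    by_cases h : m = n
    · subst h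
      rw [if_pos rfl] at hlt ⊢
      obtain ⟨l, hl, he⟩ := exists_index_of_listing hq (hobs _ (diag_mem_rep _) hlt)
      exact ⟨l, hl, he.symm⟩
    · have hne : (⟨m - 1, by omega⟩ : Fin N) ≠ ⟨n - 1, by omega⟩ := by
        rw [Ne, Fin.mk.injEq]; omega
      rw [if_neg hne] at hlt
      rw [if_neg h]
      obtain ⟨l, hl, he⟩ := exists_index_of_listing hq (hobs _ (pair_mem_rep hS hne) hlt)
      exact ⟨l, hl, he.symm⟩
  refine ⟨fun i j => ?_, ?_, hlisted, ?_, ?_, ?_, ?_, ?_, ?_⟩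
  · by_cases h : (1 ≤ i ∧ i ≤ N) ∧ (1 ≤ j ∧ j ≤ N)
    · rw [toArray_apply S h.1.1 h.1.2 h.2.1 h.2.2, toArray_apply S h.2.1 h.2.2 h.1.1 h.1.2]
      conv_lhs => rw [← hS.transpose_eq]
      rfl
    · rw [toArray, dif_neg h, toArray, dif_neg fun h' => h ⟨h'.2, h'.1⟩]
  · obtain ⟨l, hl, he⟩ := hlisted 1 1 le_rfl le_rfl hN
    rw [passValue, if_pos rfl] at he
    have h1 : 1 ∈ indexSet M := ⟨le_rfl, le_trans (by exact_mod_cast hl.1) hl.2⟩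
    -- The first diagonal entry of a reduced matrix is the minimum of all its values, and q_1 is one
    -- of them.
    refine le_antisymm ?_ (by rw [he]; exact (hq.1.le_iff_le h1 hl).2 hl.1)
    obtain ⟨v, hv, hval⟩ := hrep.symm ▸ (mem_observed_of_listing hq h1).1
    obtain ⟨j, hj⟩ := Function.ne_iff.1 hv
    rw [toArray_apply S le_rfl hN le_rfl hN, hval]
    exact hR.minimal ⟨0, hN⟩ v ⟨j, Nat.zero_le _, hj⟩
  · intro n h1 h2
    rw [toArray_apply S h1 (by omega) h1 (by omega),
      toArray_apply S (by omega) h2 (by omega) h2]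
    exact hR.diag_le (by rw [Fin.mk_le_mk]; omega)
  · intro m n h1 h2 h3
    rw [toArray_apply S h1 (by omega) h1 (by omega),
      toArray_apply S h1 (by omega) (by omega) h3]
    exact hR.pair_nonneg hS (by rw [Fin.mk_lt_mk]; omega)
  · intro n h1 h2
    rw [toArray_apply S h1 (by omega) (by omega) h2]
    exact hR.obtuse _ _ (by simp only; omega)
  · intro m n h1 h2 h3
    rw [toArray_apply S h1 (by omega) h1 (by omega),
      toArray_apply S h1 (by omega) (by omega) h3]
    exact hR.two_mul_le hS (by rw [Fin.mk_lt_mk]; omega)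
  · intro n h1 h2 j hj hlt
    rw [toArray_apply S (by omega) h2 (by omega) h2] at hlt
    rw [lead_toArray S (by omega : n ≤ N)]
    exact hR.mem_rep_submatrix ⟨n, h2⟩ (hrep.symm ▸ (mem_observed_of_listing hq hj).1) hlt
  · intro n hn
    rw [lead_toArray S hn]
    exact (hS.submatrix (Fin.castLE_injective _)).det_pos

end Observed
end LatticeEnum

/-! ### The theorem -/

theorem mainTheorem5 :
    -- no form of smaller positive rank represents all that a form of rank at most 4 represents
    (∀ N N₂ : ℕ, 0 < N₂ → N₂ < N → N ≤ 4 →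
      ∀ (S : Matrix (Fin N) (Fin N) ℝ) (S₂ : Matrix (Fin N₂) (Fin N₂) ℝ),
        S.PosDef → S₂.PosDef → ¬ LatticeEnum.Rep S ⊆ LatticeEnum.Rep S₂) ∧
    -- finitely many classes share a given set of representations
    (∀ N : ℕ, N ≤ 4 → ∀ L : Set ℝ,
      {X : Quotient (LatticeEnum.equivSetoid N) |
        ∃ S : Matrix (Fin N) (Fin N) ℝ, S.PosDef ∧ LatticeEnum.Rep S = L ∧
          X = Quotient.mk (LatticeEnum.equivSetoid N) S}.Finite) ∧
    -- the recursive procedure terminates for every bound `c ≤ ∞`, and for all large `c`,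
    -- including `c = ∞`, its output meets every class that has the given representations
    (∀ N : ℕ, 0 < N → N ≤ 4 → ∀ S₀ : Matrix (Fin N) (Fin N) ℝ, S₀.PosDef →
      (∀ c : EReal, (LatticeEnum.Observed S₀ c).Nonempty →
        ∃ (M : ℕ∞) (q : ℕ → ℝ),
          LatticeEnum.IsSortedListing (LatticeEnum.Observed S₀ c) M q ∧
          ∀ T : ℕ → ℕ → ℝ, ∃ (k : ℕ) (Ans : List (Matrix (Fin N) (Fin N) ℝ)),
            LatticeEnum.Exec N M q (LatticeEnum.call 1 1 T 1 1) k Ans ∧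
            ∀ A ∈ Ans, A.PosDef) ∧
      ∃ c₀ : ℝ, ∀ c : EReal, (c₀ : EReal) ≤ c →
        ∃ (M : ℕ∞) (q : ℕ → ℝ),
          LatticeEnum.IsSortedListing (LatticeEnum.Observed S₀ c) M q ∧
          ∀ T : ℕ → ℕ → ℝ, ∃ (k : ℕ) (Ans : List (Matrix (Fin N) (Fin N) ℝ)),
            LatticeEnum.Exec N M q (LatticeEnum.call 1 1 T 1 1) k Ans ∧
            ∀ S : Matrix (Fin N) (Fin N) ℝ, S.PosDef →
              LatticeEnum.Rep S = LatticeEnum.Rep S₀ →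
              ∃ A ∈ Ans, LatticeEnum.Equivalent S A) := by
  refine ⟨fun N N₂ _ hlt hN S S₂ hS hS₂ => LatticeEnum.not_rep_subset hlt hN S S₂ hS hS₂,
    fun N hN L => LatticeEnum.finite_classes hN L, fun N hN0 hN S₀ hS₀ => ⟨fun c hne => ?_, ?_⟩⟩
  · obtain ⟨M, q, hq⟩ := LatticeEnum.exists_listing_observed hS₀ c
    refine ⟨M, q, hq, fun T => ?_⟩
    obtain ⟨k, Ans, h1, h2, -⟩ := LatticeEnum.exec_procedure hN0
      (LatticeEnum.admissible_of_listing hN hS₀ hne hq) T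
    exact ⟨k, Ans, h1, h2⟩
  · obtain ⟨X, hX⟩ := LatticeEnum.exists_diag_bound hN hS₀
    have hbound : ∀ S : Matrix (Fin N) (Fin N) ℝ, S.PosDef → LatticeEnum.Reduced S →
        LatticeEnum.Rep S = LatticeEnum.Rep S₀ → ∀ i j, i ≤ j →
        (if i = j then S i i else S i i + S j j + 2 * S i j) < 4 * X + 1 := by
      intro S hS hR hrep i j _
      have hi := hX S hS hR hrep i
      have hj := hX S hS hR hrep j
      have hi0 : 0 < S i i := hS.diag_pos
      split_ifs with h
      · linarith
      · have := LatticeEnum.pair_le hS h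
        linarith
    -- X bounds the diagonals of all reduced matrices with these values, hence 4X bounds all
    -- quantities met in a pass; the added 1 makes the inequality strict, as the interval (0, c) is
    -- open.
    refine ⟨4 * X + 1, fun c hc => ?_⟩
    have hne : (LatticeEnum.Observed S₀ c).Nonempty := by
      obtain ⟨S, hS, hR⟩ := LatticeEnum.exists_reduced hS₀ hN
      have hmem : S ⟨0, hN0⟩ ⟨0, hN0⟩ ∈ LatticeEnum.Rep S₀ := hS.rep_eq ▸ LatticeEnum.diag_mem_rep _
      have hlt := hbound S (hS.posDef hS₀) hR hS.rep_eq ⟨0, hN0⟩ ⟨0, hN0⟩ le_rfl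
      rw [if_pos rfl] at hlt
      exact ⟨_, hmem, LatticeEnum.rep_pos hS₀ hmem, (EReal.coe_lt_coe_iff.2 hlt).trans_le hc⟩
    obtain ⟨M, q, hq⟩ := LatticeEnum.exists_listing_observed hS₀ c
    refine ⟨M, q, hq, fun T => ?_⟩
    obtain ⟨k, Ans, h1, -, h3⟩ := LatticeEnum.exec_procedure hN0
      (LatticeEnum.admissible_of_listing hN hS₀ hne hq) T
    refine ⟨k, Ans, h1, fun S hS hrep => ?_⟩
    obtain ⟨S', hS', hR⟩ := LatticeEnum.exists_reduced hS hN
    have hrep' := hS'.rep_eq.trans hrep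
    have htarget := h3 _ (LatticeEnum.target_of_reduced hN0 hq (hS'.posDef hS) hR hrep'
      fun i j hij => (EReal.coe_lt_coe_iff.2
        (hbound S' (hS'.posDef hS) hR hrep' i j hij)).trans_le hc)
    rw [LatticeEnum.lead_toArray S' le_rfl] at htarget
    exact ⟨S', by simpa using htarget, hS'⟩
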